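/- **Setting.** Let $\mathcal L_{\mathrm{DLE}}(\mathcal F,\mathcal G)$ be given by a set of proposition letters and disjoint families $\mathcal F,\mathcal G$ of connectives, each $c$ with an arity $n_c\in\mathbb N$ and an order-type $\varepsilon_c\in\{1,\partial\}^{n_c}$. Formulas are $A::=p\mid\bot\mid\top\mid A\wedge A\mid A\vee A\mid f(\vec A)\mid g(\vec A)$. The language $\mathcal L^*_{\mathrm{DLE}}$ has in addition $\to,\leftarrow$, their duals $\succ,\prec$ (left residuals of $\vee$ in the second, resp. first coordinate) and the residuals $f_i^\sharp$ ($1\le i\le n_f$) and $g_h^\flat$ ($1\le h\le n_g$). With $\mathcal F^*\ni\succ,\prec$ and $\mathcal G^*\ni\to,\leftarrow$, one has $f_i^\sharp\in\mathcal G^*$ iff $\varepsilon_f(i)=1$ (else $\in\mathcal F^*$) and $g_h^\flat\in\mathcal F^*$ iff $\varepsilon_g(h)=1$ (else $\in\mathcal G^*$). Structures are built from formulas with $\mathrm I$ (for $\top,\bot$), $;$ (for $\wedge,\vee$; order-type $(1,1)$), $>$ (for $\succ,\to$; $(\partial,1)$), $<$ (for $\prec,\leftarrow$; $(1,\partial)$),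 $H$ (for $f$), $K$ (for $g$), $H_i$ (for $f_i^\sharp$) and $K_h$ (for $g^\flat_h$). $H,K$ have the order-types of $f,g$; $H_i$ has order-type $\varepsilon_f(i)$ at $i$ and, at $j\neq i$, $\varepsilon_f(j)^\partial$ if $\varepsilon_f(i)=1$ and $\varepsilon_f(j)$ if $\varepsilon_f(i)=\partial$; likewise $K_h$. Connectives $f\in\mathcal F$, $g\in\mathcal G$ of equal arity and order-type that form a dual pair may share their structural symbols. A node of a sequent is in precedent (succedent) position if it lies in the antecedent (consequent) below an even number of coordinates of type $\partial$, or in the consequent (antecedent) below an odd number. **The calculi.** In $\mathbf{DL}$ (formulas of $\mathcal L_{\mathrm{DLE}}$) and $\mathbf{DL}^*$ (formulas of $\mathcal L^*_{\mathrm{DLE}}$) $X,Y,Z,W$ range over all structures. The rules are: - $p\vdash p$, and cut: from $X\vdash A$ and $A\vdash Y$ infer $X\vdash Y$; - (both directions) $X;Y\vdash Z\,/\,Y\vdash X>Z$; $Z\vdash X;Y\,/\,X>Z\vdash Y$; $X;Y\vdash Z\,/\,X\vdash Z<Y$; $Z\vdash X;Y\,/\,Z<Y\vdash X$; - (both directions)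 from $H(\ldots,X_i,\ldots)\vdash Y$ to $X_i\vdash H_i(\ldots,Y,\ldots)$ if $\varepsilon_f(i)=1$, to $H_i(\ldots,Y,\ldots)\vdash X_i$ if $\varepsilon_f(i)=\partial$; from $Y\vdash K(\ldots,X_h,\ldots)$ to $K_h(\ldots,Y,\ldots)\vdash X_h$ if $\varepsilon_g(h)=1$, to $X_h\vdash K_h(\ldots,Y,\ldots)$ if $\varepsilon_g(h)=\partial$; - necessitation: from $X_k\vdash\mathrm I$ infer $X_k\vdash H_k(X_1,\ldots,\mathrm I,\ldots,X_{n_f})$ if $\varepsilon_f(k)=1$; from $\mathrm I\vdash X_k$ infer $H_k(X_1,\ldots,\mathrm I,\ldots,X_{n_f})\vdash X_k$ if $\varepsilon_f(k)=\partial$; from $\mathrm I\vdash X_h$ infer $K_h(X_1,\ldots,\mathrm I,\ldots,X_{n_g})\vdash X_h$ if $\varepsilon_g(h)=1$; from $X_h\vdash\mathrm I$ infer $X_h\vdash K_h(X_1,\ldots,\mathrm I,\ldots,X_{n_g})$ if $\varepsilon_g(h)=\partial$ ($\mathrm I$ in coordinate $k$, resp. $h$); - (both directions) $X\vdash Y\,/\,\mathrm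 I;X\vdash Y$; $Y\vdash X\,/\,Y\vdash X;\mathrm I$; $X;(Y;Z)\vdash W\,/\,(X;Y);Z\vdash W$; $W\vdash(Z;Y);X\,/\,W\vdash Z;(Y;X)$; and exchange, weakening and contraction for $;$ on both sides; - for every operational connective $c$ of the language with structural counterpart $S$: if $c\in\{\top,\wedge\}$ or $c$ is of the $\mathcal F$-kind (in $\mathcal F$ for $\mathbf{DL}$, in $\mathcal F^*$ for $\mathbf{DL}^*$), from $S(\vec A)\vdash X$ infer $c(\vec A)\vdash X$, and from all $X_i\vdash A_i$ ($\varepsilon(i)=1$) and $A_j\vdash X_j$ ($\varepsilon(j)=\partial$) infer $S(\vec X)\vdash c(\vec A)$; if $c\in\{\bot,\vee\}$ or $c$ is of the $\mathcal G$-kind, from $X\vdash S(\vec A)$ infer $X\vdash c(\vec A)$, and from all $A_i\vdash X_i$ ($\varepsilon(i)=1$) and $X_j\vdash A_j$ ($\varepsilon(j)=\partial$) infer $c(\vec A)\vdash S(\vec X)$. **Conditions.** The *parameters* of an application of a rule are the occurrences of substructures inside structures instantiating structure variables; two are *congruent* if they occupy the same place in occurrences of the same structure variable. A *principal* occurrence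 is a non-parametric formula occurrence (as a leaf) in the conclusion. The conditions are: - C$_1$ (for the rules other than cut): every formula occurring in a premise is a subformula of a formula occurring in the conclusion. - C$_2$: congruent parameters are occurrences of the same structure. - C$_3$: each parameter is congruent to at most one parameter of the conclusion. - C$_4$: congruent parameters are in the same (precedent or succedent) position. - C$_5$: principal occurrences are the entire antecedent or the entire consequent. - C$_6$ (C$_7$): replacing all occurrences congruent to a given parametric formula in succedent (precedent) position by an arbitrary structure again gives an application of the same rule. - C$_8$: if $X\vdash A$ and $A\vdash Y$ are conclusions of rule applications (of rules other than cut) in both of which the displayed $A$ is principal, then $X\vdash Y$ is derivable from the premises of these two applications with cuts only on proper subformulas of $A$. A *proper display calculus* is one that satisfies C$_1$–C$_8$. **Theorem.** For every such language: 1. $\mathbf{DL}$ and $\mathbf{DL}^*$ are proper display calculi. Hence they enjoy cut elimination (every derivable sequent has a cut-free derivation) and the subformula property (every derivable sequent has a cut-free derivation in which every formula is a subformula of a formula occurring in that sequent). 2. Let the necessitation rules be given, for each coordinate $i$ other than the distinguished one, the further premise $X_i\vdash Y_i$ (if $\varepsilon_f(i)=1$) or $Y_i\vdash X_i$ (if $\varepsilon_f(i)=\partial$)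 in the case of $f$, and $Y_i\vdash X_i$ (if $\varepsilon_g(i)=1$) or $X_i\vdash Y_i$ (if $\varepsilon_g(i)=\partial$) in the case of $g$, where $Y_i$ is a new structure variable that does not occur in the conclusion. The calculi so modified derive the same sequents as $\mathbf{DL}$, resp. $\mathbf{DL}^*$; they satisfy C$_2$–C$_8$ and enjoy cut elimination and the subformula property. -/

import Mathlib

universe u

namespace DLE

/-- A DLE-language together with its structural symbols. `F` and `G` are the two (disjoint) families
of connectives; `H f` and `K g` are the structural symbols of `f` and `g`. The arity `n_f` and the
order-type `ε_f` of `f` are those of `H f` (likewise for `g`); `true` stands for `1` and `false` for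
`∂`. Two connectives `f`, `g` with `H f = K g` form a dual pair sharing one structural symbol; if
there is no such pair, then all structural symbols are distinct (see `Language.mk'`). -/
structure Language where
  At : Type u
  F : Type u
  G : Type u
  S : Type u
  arity : S → ℕ
  ord : (s : S) → Fin (arity s) → Bool
  H : F → S
  K : G → S
  H_injective : Function.Injective H
  K_injective : Function.Injective K
  H_or_K : ∀ s, (∃ f, H f = s) ∨ (∃ g, K g = s)

/-- The language given by arbitrary families `F`, `G` with arities and order-types, with pairwise
distinct structural symbols. -/
def Language.mk' (At F G : Type u) (nF : F → ℕ) (nG : G → ℕ)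
    (εF : (f : F) → Fin (nF f) → Bool) (εG : (g : G) → Fin (nG g) → Bool) : Language.{u} where
  At := At
  F := F
  G := G
  S := F ⊕ G
  arity := Sum.elim nF nG
  ord := fun s => match s with
    | Sum.inl f => εF f
    | Sum.inr g => εG g
  H := Sum.inl
  K := Sum.inr
  H_injective := Sum.inl_injective
  K_injective := Sum.inr_injective
  H_or_K := fun s => match s with
    | Sum.inl f => Or.inl ⟨f, rfl⟩
    | Sum.inr g => Or.inr ⟨g, rfl⟩

variable {L : Language.{u}} {st : Bool}

/-! ### Structural connectives and structures -/

/-- Structural connectives: `I`, `;`, `>`, `<`, the symbols `H`, `K` (`str s`) and their residuals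
`H_i`, `K_i` (`res s i`). -/
inductive SConn (L : Language.{u}) : Type u
  | I : SConn L
  | semi : SConn L
  | gt : SConn L
  | lt : SConn L
  | str (s : L.S) : SConn L
  | res (s : L.S) (i : Fin (L.arity s)) : SConn L

def SConn.arity : SConn L → ℕ
  | .I => 0
  | .semi => 2
  | .gt => 2
  | .lt => 2
  | .str s => L.arity s
  | .res s _ => L.arity s

/-- The order-type of a structural connective (`true` is `1`, `false` is `∂`). -/
def SConn.ord : (c : SConn L) → Fin c.arity → Bool
  | .I => fun _ => true
  | .semi => fun _ => true
  | .gt => ![false, true]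
  | .lt => ![true, false]
  | .str s => L.ord s
  | .res s i => fun (j : Fin (L.arity s)) =>
      if j = i then L.ord s i else if L.ord s i then !(L.ord s j) else L.ord s j

/-- Structural terms with leaves in `α`. -/
inductive Str (L : Language.{u}) (α : Type u) : Type u
  | leaf (a : α) : Str L α
  | node (c : SConn L) (args : Fin c.arity → Str L α) : Str L α

namespace Str

variable {α β : Type u}

/-- Simultaneous substitution for the leaves. -/
def subst (σ : α → Str L β) : Str L α → Str L β
  | leaf a => σ a
  | node c args => node c fun i => (args i).subst σ

/-- The set of leaves. -/
def leaves : Str L α → Set α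
  | leaf a => {a}
  | node _ args => ⋃ i, (args i).leaves

/-- The substructure at a node of the generation tree, the node being given by its path (the list of
coordinates, counted from `0`, that leads to it from the root); `none` if there is no such node. -/
def get : Str L α → List ℕ → Option (Str L α)
  | t, [] => some t
  | leaf _, _ :: _ => none
  | node c args, i :: p => if h : i < c.arity then (args ⟨i, h⟩).get p else none

/-- The sign of a node in the positive signed generation tree: the number of coordinates of
order-type `∂` along the path is even (`true`) or odd (`false`). -/
def sign : Str L α → List ℕ → Bool
  | _, [] => true
  | leaf _, _ :: _ => true
  | node c args, i :: p =>
      if h : i < c.arity then (c.ord ⟨i, h⟩ == (args ⟨i, h⟩).sign p) else true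

open Classical in
/-- Replace the substructures at all nodes whose path is in `P` by `Z`. -/
noncomputable def replace : Str L α → Set (List ℕ) → Str L α → Str L α
  | leaf a, P, Z => if [] ∈ P then Z else leaf a
  | node c args, P, Z =>
      if [] ∈ P then Z else node c fun i => (args i).replace {p | (i : ℕ) :: p ∈ P} Z

def I : Str L α := node .I ![]
def semi (X Y : Str L α) : Str L α := node .semi ![X, Y]
def gt (X Y : Str L α) : Str L α := node .gt ![X, Y]
def lt (X Y : Str L α) : Str L α := node .lt ![X, Y]
def str (s : L.S) (X : Fin (L.arity s) → Str L α) : Str L α := node (.str s) X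
def res (s : L.S) (i : Fin (L.arity s)) (X : Fin (L.arity s) → Str L α) : Str L α :=
  node (.res s i) X

end Str

/-- A sequent `ante ⊢ succ`. -/
structure Seq (L : Language.{u}) (α : Type u) : Type u where
  ante : Str L α
  succ : Str L α

namespace Seq

variable {α β : Type u}

/-- The antecedent (`true`) or the consequent (`false`) of a sequent. -/
def side (s : Seq L α) : Bool → Str L α
  | true => s.ante
  | false => s.succ

def subst (σ : α → Str L β) (s : Seq L α) : Seq L β := ⟨s.ante.subst σ, s.succ.subst σ⟩

/-- The set of leaves occurring in a sequent. -/
def leaves (s : Seq L α) : Set α := s.ante.leaves ∪ s.succ.leaves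

end Seq

/-! ### Operational connectives and formulas -/

/-- Operational connectives. With `st = false` these are the connectives of the language
`L_DLE(F, G)`, with `st = true` those of the expanded language `L_DLE(F*, G*)`.
`imp` is `→`, `coimp` is its dual (left residual of `∨` in the second coordinate), `impBy` is `←` and
`coimpBy` is its dual. -/
inductive OConn (L : Language.{u}) (st : Bool) : Type u
  | top : OConn L st
  | bot : OConn L st
  | and : OConn L st
  | or : OConn L st
  | ofF (f : L.F) : OConn L st
  | ofG (g : L.G) : OConn L st
  | imp (h : st = true) : OConn L st
  | coimp (h : st = true) : OConn L st
  | impBy (h : st = true) : OConn L st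
  | coimpBy (h : st = true) : OConn L st
  | sharp (h : st = true) (f : L.F) (i : Fin (L.arity (L.H f))) : OConn L st
  | flat (h : st = true) (g : L.G) (i : Fin (L.arity (L.K g))) : OConn L st

/-- The structural connective that corresponds to an operational connective. -/
def OConn.toS : OConn L st → SConn L
  | .top => .I
  | .bot => .I
  | .and => .semi
  | .or => .semi
  | .ofF f => .str (L.H f)
  | .ofG g => .str (L.K g)
  | .imp _ => .gt
  | .coimp _ => .gt
  | .impBy _ => .lt
  | .coimpBy _ => .lt
  | .sharp _ f i => .res (L.H f) i
  | .flat _ g i => .res (L.K g) i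

/-- `true` if the structural connective translates to this operational connective in precedent
position (`⊤`, `∧` and the members of `F*`), `false` if it does so in succedent position
(`⊥`, `∨` and the members of `G*`). -/
def OConn.inF : OConn L st → Bool
  | .top => true
  | .bot => false
  | .and => true
  | .or => false
  | .ofF _ => true
  | .ofG _ => false
  | .imp _ => false
  | .coimp _ => true
  | .impBy _ => false
  | .coimpBy _ => true
  | .sharp _ f i => !(L.ord (L.H f) i)
  | .flat _ g i => L.ord (L.K g) i

inductive Fm (L : Language.{u}) (st : Bool) : Type u
  | atom (p : L.At) : Fm L st
  | app (c : OConn L st) (args : Fin c.toS.arity → Fm L st) : Fm L st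

/-- `Sub A B`: the formula `A` is a subformula of `B`. -/
inductive Sub : Fm L st → Fm L st → Prop
  | refl (A : Fm L st) : Sub A A
  | arg {A : Fm L st} (c : OConn L st) (B : Fin c.toS.arity → Fm L st) (i : Fin c.toS.arity) :
      Sub A (B i) → Sub A (Fm.app c B)

/-- Structures, i.e. structural terms over formulas. -/
abbrev Structure (L : Language.{u}) (st : Bool) := Str L (Fm L st)

/-- Sequents of structures. -/
abbrev Sequent (L : Language.{u}) (st : Bool) := Seq L (Fm L st)

/-- A formula as a structure. -/
abbrev Fm.str (A : Fm L st) : Structure L st := Str.leaf A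

/-! ### Rules, congruence, calculi -/

/-- A node in one of the sequents of a rule application with `k` premises: `loc` is `none` for the
conclusion and `some i` for the `i`-th premise; `ante` tells whether the node lies in the
antecedent. -/
structure Occ (k : ℕ) where
  loc : Option (Fin k)
  ante : Bool
  path : List ℕ

/-- An application of a rule with `k` premises: the conclusion `seq none`, the premises
`seq (some i)`, and the congruence relation, a partial equivalence relation whose domain is the set
of parameters. -/
structure Application (L : Language.{u}) (st : Bool) (k : ℕ) where
  seq : Option (Fin k) → Sequent L st
  cong : Occ k → Occ k → Prop
  cong_symm : ∀ o o', cong o o' → cong o' o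
  cong_trans : ∀ o o' o'', cong o o' → cong o' o'' → cong o o''

namespace Application

variable {k : ℕ}

/-- The substructure that occurs at a node. -/
def sub (a : Application L st k) (o : Occ k) : Option (Structure L st) :=
  ((a.seq o.loc).side o.ante).get o.path

/-- The node is in precedent position. -/
def Precedent (a : Application L st k) (o : Occ k) : Prop :=
  ((a.seq o.loc).side o.ante).sign o.path = o.ante

/-- The node is a parameter. -/
def IsParam (a : Application L st k) (o : Occ k) : Prop := a.cong o o

/-- The node is a principal occurrence of the formula `A`: a non-parametric occurrence of `A` in the
conclusion. -/
def IsPrincipal (a : Application L st k) (o : Occ k) (A : Fm L st) : Prop :=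
  o.loc = none ∧ a.sub o = some A.str ∧ ¬ a.IsParam o

/-- The sequents obtained by replacing with `Z` all nodes that are congruent to `o`. -/
noncomputable def replaceSeq (a : Application L st k) (o : Occ k) (Z : Structure L st)
    (l : Option (Fin k)) : Sequent L st where
  ante := (a.seq l).ante.replace {p | a.cong o ⟨l, true, p⟩} Z
  succ := (a.seq l).succ.replace {p | a.cong o ⟨l, false, p⟩} Z

end Application

/-- A rule, as the set of its applications. -/
structure Rule (L : Language.{u}) (st : Bool) where
  k : ℕ
  apps : Set (Application L st k)

/-- A schematic rule: its premises and its conclusion are built from structure variables (left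
summand) and formulas (right summand). -/
structure Scheme (L : Language.{u}) (st : Bool) where
  k : ℕ
  seq : Option (Fin k) → Seq L (ℕ ⊕ Fm L st)

/-- The structure variable occurrence of a schematic structure below which a node of an instance
lies, and the path from there to the node; `none` if the node does not lie inside a structure
assigned to a structure variable. -/
def Str.param : Str L (ℕ ⊕ Fm L st) → List ℕ → Option (ℕ × List ℕ)
  | .leaf (Sum.inl v), q => some (v, q)
  | .leaf (Sum.inr _), _ => none
  | .node _ _, [] => none
  | .node c args, i :: p => if h : i < c.arity then (args ⟨i, h⟩).param p else none

/-- The instance of a schematic rule under an assignment `σ` of structures to structure variables.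
Its parameters are the nodes of the structures assigned to structure variables; two of them are
congruent iff they occupy the same place in occurrences of one and the same structure variable. -/
def Scheme.inst (r : Scheme L st) (σ : ℕ → Structure L st) : Application L st r.k where
  seq := fun l => (r.seq l).subst (Sum.elim (fun v => σ v) Str.leaf)
  cong := fun o o' => ∃ v q, ((σ v).get q).isSome = true ∧
    ((r.seq o.loc).side o.ante).param o.path = some (v, q) ∧
    ((r.seq o'.loc).side o'.ante).param o'.path = some (v, q)
  cong_symm := fun _ _ ⟨v, q, h, h₁, h₂⟩ => ⟨v, q, h, h₂, h₁⟩
  cong_trans := by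
    rintro o o' o'' ⟨v, q, h, h₁, h₂⟩ ⟨v', q', _, h₃, h₄⟩
    rw [h₂] at h₃
    cases h₃
    exact ⟨v, q, h, h₁, h₄⟩

def Scheme.toRule (r : Scheme L st) : Rule L st := ⟨r.k, Set.range r.inst⟩

/-- A display calculus, given by its rules other than cut; cut is part of every calculus. -/
abbrev Calculus (L : Language.{u}) (st : Bool) := Set (Rule L st)

/-- Schematic structures and sequents. -/
abbrev SStr (L : Language.{u}) (st : Bool) := Str L (ℕ ⊕ Fm L st)
abbrev SSeq (L : Language.{u}) (st : Bool) := Seq L (ℕ ⊕ Fm L st)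

/-- The `n`-th structure variable. -/
def sv (n : ℕ) : SStr L st := Str.leaf (Sum.inl n)

/-- A formula as a schematic structure. -/
def sf (A : Fm L st) : SStr L st := Str.leaf (Sum.inr A)

/-- Cut on `A`. -/
def cutScheme (A : Fm L st) : Scheme L st where
  k := 2
  seq := fun l => match l with
    | none => ⟨sv 0, sv 1⟩
    | some 0 => ⟨sv 0, sf A⟩
    | some 1 => ⟨sf A, sv 1⟩

/-- All rules of a calculus, including cut. -/
def Calculus.allRules (C : Calculus L st) : Set (Rule L st) :=
  C ∪ Set.range fun A => (cutScheme A).toRule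

/-- Derivations from the set `Hy` of hypotheses. -/
inductive Derivation (C : Calculus L st) (Hy : Set (Sequent L st)) : Sequent L st → Type u
  | hyp {s : Sequent L st} (h : s ∈ Hy) : Derivation C Hy s
  | rule (R : Rule L st) (hR : R ∈ C) (a : Application L st R.k) (ha : a ∈ R.apps)
      (d : ∀ i, Derivation C Hy (a.seq (some i))) : Derivation C Hy (a.seq none)
  | cut {X Y : Structure L st} (A : Fm L st) (d₁ : Derivation C Hy ⟨X, A.str⟩)
      (d₂ : Derivation C Hy ⟨A.str, Y⟩) : Derivation C Hy ⟨X, Y⟩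

namespace Derivation

variable {C : Calculus L st} {Hy : Set (Sequent L st)}

/-- The cut formulas of a derivation. -/
def cuts : {s : Sequent L st} → Derivation C Hy s → Set (Fm L st)
  | _, hyp _ => ∅
  | _, rule _ _ _ _ d => ⋃ i, (d i).cuts
  | _, cut A d₁ d₂ => {A} ∪ (d₁.cuts ∪ d₂.cuts)

/-- The formulas that occur in the sequents of a derivation. -/
def formulas : {s : Sequent L st} → Derivation C Hy s → Set (Fm L st)
  | s, hyp _ => s.leaves
  | _, rule _ _ a _ d => (a.seq none).leaves ∪ ⋃ i, (d i).formulas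
  | s, cut _ d₁ d₂ => s.leaves ∪ (d₁.formulas ∪ d₂.formulas)

end Derivation

/-! ### The conditions on a proper display calculus -/

namespace Calculus

/-- Preservation of formulas. -/
def C1 (C : Calculus L st) : Prop :=
  ∀ R ∈ C, ∀ a ∈ R.apps, ∀ i, ∀ A ∈ (a.seq (some i)).leaves, ∃ B ∈ (a.seq none).leaves, Sub A B

/-- Shape-alikeness of parameters. -/
def C2 (C : Calculus L st) : Prop :=
  ∀ R ∈ C.allRules, ∀ a ∈ R.apps, ∀ o o', a.cong o o' →
    ∃ X, a.sub o = some X ∧ a.sub o' = some X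

/-- Non-proliferation of parameters. -/
def C3 (C : Calculus L st) : Prop :=
  ∀ R ∈ C.allRules, ∀ a ∈ R.apps, ∀ o o₁ o₂, o₁.loc = none → o₂.loc = none →
    a.cong o o₁ → a.cong o o₂ → o₁ = o₂

/-- Position-alikeness of parameters. -/
def C4 (C : Calculus L st) : Prop :=
  ∀ R ∈ C.allRules, ∀ a ∈ R.apps, ∀ o o', a.cong o o' → (a.Precedent o ↔ a.Precedent o')

/-- Display of principal constituents. -/
def C5 (C : Calculus L st) : Prop :=
  ∀ R ∈ C.allRules, ∀ a ∈ R.apps, ∀ (o : Occ R.k) (A : Fm L st), a.IsPrincipal o A → o.path = []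

/-- Closure under substitution for succedent parameters. -/
def C6 (C : Calculus L st) : Prop :=
  ∀ R ∈ C.allRules, ∀ a ∈ R.apps, ∀ (o : Occ R.k) (A : Fm L st), a.IsParam o → a.sub o = some A.str → ¬ a.Precedent o →
    ∀ Z : Structure L st, ∃ a' ∈ R.apps, ∀ l, a'.seq l = a.replaceSeq o Z l

/-- Closure under substitution for precedent parameters. -/
def C7 (C : Calculus L st) : Prop :=
  ∀ R ∈ C.allRules, ∀ a ∈ R.apps, ∀ (o : Occ R.k) (A : Fm L st), a.IsParam o → a.sub o = some A.str → a.Precedent o →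
    ∀ Z : Structure L st, ∃ a' ∈ R.apps, ∀ l, a'.seq l = a.replaceSeq o Z l

/-- Eliminability of matching principal constituents: if `A` is principal in the last inferences
`a₁` of `X ⊢ A` and `a₂` of `A ⊢ Y`, then `X ⊢ Y` is derivable from the premises of `a₁` and `a₂`
with all cuts on proper subformulas of `A`. -/
def C8 (C : Calculus L st) : Prop :=
  ∀ R₁ ∈ C, ∀ a₁ ∈ R₁.apps, ∀ R₂ ∈ C, ∀ a₂ ∈ R₂.apps, ∀ (X Y : Structure L st) (A : Fm L st),
    a₁.seq none = ⟨X, A.str⟩ → a₁.IsPrincipal ⟨none, false, []⟩ A →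
    a₂.seq none = ⟨A.str, Y⟩ → a₂.IsPrincipal ⟨none, true, []⟩ A →
    ∃ d : Derivation C
        ((Set.range fun i => a₁.seq (some i)) ∪ (Set.range fun i => a₂.seq (some i))) ⟨X, Y⟩,
      ∀ B ∈ d.cuts, Sub B A ∧ B ≠ A

/-- Proper display calculi. -/
structure IsProper (C : Calculus L st) : Prop where
  c1 : C.C1
  c2 : C.C2
  c3 : C.C3
  c4 : C.C4
  c5 : C.C5
  c6 : C.C6
  c7 : C.C7
  c8 : C.C8

/-- The sequent is derivable (cut being allowed). -/
def Derivable (C : Calculus L st) (s : Sequent L st) : Prop := Nonempty (Derivation C ∅ s)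

/-- Every derivable sequent has a cut-free derivation. -/
def CutElimination (C : Calculus L st) : Prop :=
  ∀ s, C.Derivable s → ∃ d : Derivation C ∅ s, d.cuts = ∅

/-- Every derivable sequent has a cut-free derivation in which only subformulas of formulas of that
sequent occur. -/
def SubformulaProperty (C : Calculus L st) : Prop :=
  ∀ s, C.Derivable s → ∃ d : Derivation C ∅ s, d.cuts = ∅ ∧
    ∀ A ∈ d.formulas, ∃ B ∈ s.leaves, Sub A B

end Calculus

/-! ### The calculi DL and DL* -/

/-- The schematic rule without premises. -/
def Scheme.axiomatic (c : SSeq L st) : Scheme L st where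
  k := 0
  seq := fun l => match l with
    | none => c
    | some i => i.elim0

/-- The schematic rule `p / c` with one premise. -/
def Scheme.unary (p c : SSeq L st) : Scheme L st where
  k := 1
  seq := fun l => match l with
    | none => c
    | some _ => p

/-- The schematic rule with premises `p i` and conclusion `c`. -/
def Scheme.multi {n : ℕ} (p : Fin n → SSeq L st) (c : SSeq L st) : Scheme L st where
  k := n
  seq := fun l => match l with
    | none => c
    | some i => p i

/-- `X ⊢ Y` if `b` is `true`, `Y ⊢ X` if `b` is `false`. -/
def dirSeq (b : Bool) (X Y : SStr L st) : SSeq L st := if b then ⟨X, Y⟩ else ⟨Y, X⟩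

/-- The two sequents of an invertible (double line) rule: display postulates, and the invertible
structural rules. -/
inductive DoubleLine : SSeq L st → SSeq L st → Prop
  | semi_gt : DoubleLine ⟨(sv 0).semi (sv 1), sv 2⟩ ⟨sv 1, (sv 0).gt (sv 2)⟩
  | gt_semi : DoubleLine ⟨sv 2, (sv 0).semi (sv 1)⟩ ⟨(sv 0).gt (sv 2), sv 1⟩
  | semi_lt : DoubleLine ⟨(sv 0).semi (sv 1), sv 2⟩ ⟨sv 0, (sv 2).lt (sv 1)⟩
  | lt_semi : DoubleLine ⟨sv 2, (sv 0).semi (sv 1)⟩ ⟨(sv 2).lt (sv 1), sv 0⟩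
  /- Display postulates for `f`: from `H(X₁,…,Xₙ) ⊢ Y` to `Xᵢ ⊢ Hᵢ(X₁,…,Y,…,Xₙ)` if `ε(i) = 1`, and
  to `Hᵢ(X₁,…,Y,…,Xₙ) ⊢ Xᵢ` if `ε(i) = ∂`; here `Y` is the structure variable number `n`. -/
  | displayF (f : L.F) (i : Fin (L.arity (L.H f))) :
      DoubleLine ⟨Str.str (L.H f) fun j => sv j, sv (L.arity (L.H f))⟩
        (dirSeq (L.ord (L.H f) i) (sv i)
          (Str.res (L.H f) i (Function.update (fun j => sv j) i (sv (L.arity (L.H f))))))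
  | displayG (g : L.G) (i : Fin (L.arity (L.K g))) :
      DoubleLine ⟨sv (L.arity (L.K g)), Str.str (L.K g) fun j => sv j⟩
        (dirSeq (L.ord (L.K g) i)
          (Str.res (L.K g) i (Function.update (fun j => sv j) i (sv (L.arity (L.K g))))) (sv i))
  | I_L : DoubleLine ⟨sv 0, sv 1⟩ ⟨Str.I.semi (sv 0), sv 1⟩
  | I_R : DoubleLine ⟨sv 1, sv 0⟩ ⟨sv 1, (sv 0).semi Str.I⟩
  | A_L : DoubleLine ⟨(sv 0).semi ((sv 1).semi (sv 2)), sv 3⟩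
      ⟨((sv 0).semi (sv 1)).semi (sv 2), sv 3⟩
  | A_R : DoubleLine ⟨sv 3, ((sv 2).semi (sv 1)).semi (sv 0)⟩
      ⟨sv 3, (sv 2).semi ((sv 1).semi (sv 0))⟩

/-- The rules other than the necessitation rules. -/
inductive BaseRule : Scheme L st → Prop
  | id (p : L.At) : BaseRule (Scheme.axiomatic ⟨sf (.atom p), sf (.atom p)⟩)
  | down {s t : SSeq L st} : DoubleLine s t → BaseRule (Scheme.unary s t)
  | up {s t : SSeq L st} : DoubleLine s t → BaseRule (Scheme.unary t s)
  | E_L : BaseRule (Scheme.unary ⟨(sv 1).semi (sv 0), sv 2⟩ ⟨(sv 0).semi (sv 1), sv 2⟩)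
  | E_R : BaseRule (Scheme.unary ⟨sv 2, (sv 0).semi (sv 1)⟩ ⟨sv 2, (sv 1).semi (sv 0)⟩)
  | W_L : BaseRule (Scheme.unary ⟨sv 1, sv 2⟩ ⟨(sv 0).semi (sv 1), sv 2⟩)
  | W_R : BaseRule (Scheme.unary ⟨sv 2, sv 1⟩ ⟨sv 2, (sv 1).semi (sv 0)⟩)
  | C_L : BaseRule (Scheme.unary ⟨(sv 0).semi (sv 0), sv 1⟩ ⟨sv 0, sv 1⟩)
  | C_R : BaseRule (Scheme.unary ⟨sv 1, (sv 0).semi (sv 0)⟩ ⟨sv 1, sv 0⟩)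
  /- Introduction rules of `⊤`, `∧` and the connectives of the family `F` (or `F*`), with `S` the
  structural counterpart of `c`: from `S(A₁,…,Aₙ) ⊢ X` infer `c(A₁,…,Aₙ) ⊢ X`; from `Xᵢ ⊢ Aᵢ`
  (`ε(i) = 1`) and `Aᵢ ⊢ Xᵢ` (`ε(i) = ∂`) infer `S(X₁,…,Xₙ) ⊢ c(A₁,…,Aₙ)`. -/
  | leftF (c : OConn L st) (h : c.inF = true) (A : Fin c.toS.arity → Fm L st) :
      BaseRule (Scheme.unary ⟨.node c.toS fun i => sf (A i), sv 0⟩ ⟨sf (.app c A), sv 0⟩)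
  | rightF (c : OConn L st) (h : c.inF = true) (A : Fin c.toS.arity → Fm L st) :
      BaseRule (Scheme.multi (fun i => dirSeq (c.toS.ord i) (sv i) (sf (A i)))
        ⟨.node c.toS fun i => sv i, sf (.app c A)⟩)
  /- Introduction rules of `⊥`, `∨` and the connectives of the family `G` (or `G*`). -/
  | rightG (c : OConn L st) (h : c.inF = false) (A : Fin c.toS.arity → Fm L st) :
      BaseRule (Scheme.unary ⟨sv 0, .node c.toS fun i => sf (A i)⟩ ⟨sv 0, sf (.app c A)⟩)
  | leftG (c : OConn L st) (h : c.inF = false) (A : Fin c.toS.arity → Fm L st) :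
      BaseRule (Scheme.multi (fun i => dirSeq (c.toS.ord i) (sf (A i)) (sv i))
        ⟨sf (.app c A), .node c.toS fun i => sv i⟩)

/-- The necessitation rules: for `f` and `k`, from `Xₖ ⊢ I` infer `Xₖ ⊢ Hₖ(X₁,…,I,…,Xₙ)` if
`ε(k) = 1`, and from `I ⊢ Xₖ` infer `Hₖ(X₁,…,I,…,Xₙ) ⊢ Xₖ` if `ε(k) = ∂`; dually for `g`. -/
inductive NecRule : Scheme L st → Prop
  | necF (f : L.F) (k : Fin (L.arity (L.H f))) :
      NecRule (Scheme.unary (dirSeq (L.ord (L.H f) k) (sv k) Str.I)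
        (dirSeq (L.ord (L.H f) k) (sv k)
          (Str.res (L.H f) k (Function.update (fun j => sv j) k Str.I))))
  | necG (g : L.G) (k : Fin (L.arity (L.K g))) :
      NecRule (Scheme.unary (dirSeq (L.ord (L.K g) k) Str.I (sv k))
        (dirSeq (L.ord (L.K g) k)
          (Str.res (L.K g) k (Function.update (fun j => sv j) k Str.I)) (sv k)))

/-- The necessitation rules with additional premises: for every `i ≠ k`, a premise `Xᵢ ⊢ Yᵢ` or
`Yᵢ ⊢ Xᵢ` (according to the order-type), where `Yᵢ` does not occur in the conclusion. -/
inductive GuardedNecRule : Scheme L st → Prop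
  | necF (f : L.F) (k : Fin (L.arity (L.H f))) :
      GuardedNecRule (Scheme.multi
        (fun i => if i = k then dirSeq (L.ord (L.H f) k) (sv k) Str.I
          else dirSeq (L.ord (L.H f) i) (sv i) (sv (L.arity (L.H f) + i)))
        (dirSeq (L.ord (L.H f) k) (sv k)
          (Str.res (L.H f) k (Function.update (fun j => sv j) k Str.I))))
  | necG (g : L.G) (k : Fin (L.arity (L.K g))) :
      GuardedNecRule (Scheme.multi
        (fun i => if i = k then dirSeq (L.ord (L.K g) k) Str.I (sv k)
          else dirSeq (L.ord (L.K g) i) (sv (L.arity (L.K g) + i)) (sv i))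
        (dirSeq (L.ord (L.K g) k)
          (Str.res (L.K g) k (Function.update (fun j => sv j) k Str.I)) (sv k)))

/-- The calculus in the language `L_DLE` (`st = false`) or `L_DLE*` (`st = true`). -/
def calculus (L : Language.{u}) (st : Bool) : Calculus L st :=
  {R | ∃ r : Scheme L st, (BaseRule r ∨ NecRule r) ∧ R = r.toRule}

/-- The same calculus with the additional premises in the necessitation rules. -/
def guardedCalculus (L : Language.{u}) (st : Bool) : Calculus L st :=
  {R | ∃ r : Scheme L st, (BaseRule r ∨ GuardedNecRule r) ∧ R = r.toRule}

/-- The display calculus DL. -/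
def DL (L : Language.{u}) : Calculus L false := calculus L false

/-- The display calculus DL*. -/
def DLstar (L : Language.{u}) : Calculus L true := calculus L true

end DLE

/-! Every rule is a scheme: its applications are all instances under assignments of structures to
structure variables, and congruent nodes lie at the same place of copies of one variable. C₂, C₆ and
C₇ hold for any such rule, since replacing a congruence class amounts to changing the value of one
variable. The other structural conditions are read off the scheme (`Scheme.Regular`): a consistent
sign for each variable gives C₄, absence of repeated variables in the conclusion gives C₃, and C₅
holds because each side of the conclusion is either free of formulas or a single formula. C₁ asks
that variables and formulas of the premises be accounted for in the conclusion (`Scheme.Analytic`).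

For C₈, two matching introductions of `c(A₁,…,Aₙ)` leave `S(A₁,…,Aₙ)` on one side of a sequent,
together with sequents relating each `Aᵢ` to `Xᵢ`. By the display postulates each argument of `S`
can be isolated, cut against its `Xᵢ`, and put back (`Der.cut_arguments`). A symbol of the `G`-kind
is treated as one of the `F`-kind with the two sides exchanged; a Boolean records the side.

Cut elimination is an induction on the cut formula. In a cut-free derivation of `X ⊢ A`, the
displayed succedent `A` is traced upwards and replaced by `Y`; regularity keeps every rule
application correct (`Der.repl`). Where `A` is principal, the same tracing is done in the derivation
of `A ⊢ Y`, with the antecedent of the introducing inference in place of `A`. Where `A` is principal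
there too, C₈ leaves cuts on proper subformulas only. Together with C₁ this gives the subformula
property.

The guarded necessitation rules violate C₁ in general, because `Yᵢ` disappears. Their subformula
property is obtained by translation: forgetting the additional premises leads to the plain calculus,
and a plain cut-free derivation is turned back by producing `Yᵢ` from the distinguished premise
through weakening and display, without new formulas. For this reason `Der` records a set `Q`
bounding the formulas that occur. -/

namespace DLE

variable {L : Language.{u}} {st : Bool}

/-! ### Schematic structures -/

namespace Str

/-- Every occurrence of a structure variable `v` has the position `pol v`, if the whole structure
has the position `b` (`true` is precedent position). -/
def Pol (pol : ℕ → Bool) : Bool → SStr L st → Prop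
  | b, leaf (Sum.inl v) => pol v = b
  | _, leaf (Sum.inr _) => True
  | b, node c args => ∀ i, Pol pol (b == c.ord i) (args i)

/-- The structure variables of a schematic structure. -/
def vars : SStr L st → Set ℕ
  | leaf (Sum.inl v) => {v}
  | leaf (Sum.inr _) => ∅
  | node _ args => ⋃ i, (args i).vars

/-- No structure variable occurs twice. -/
def Linear : SStr L st → Prop
  | leaf _ => True
  | node _ args => (∀ i, (args i).Linear) ∧ ∀ i j, i ≠ j → Disjoint (args i).vars (args j).vars

/-- No formula occurs. -/
def Bare : SStr L st → Prop
  | leaf (Sum.inl _) => True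
  | leaf (Sum.inr _) => False
  | node _ args => ∀ i, (args i).Bare

/-- Instantiation of the structure variables. -/
abbrev inst (t : SStr L st) (σ : ℕ → Structure L st) : Structure L st :=
  t.subst (Sum.elim (fun v => σ v) leaf)

theorem get_inst {σ : ℕ → Structure L st} {v : ℕ} {q : List ℕ} :
    ∀ {t : SStr L st} {p : List ℕ}, t.param p = some (v, q) → (t.inst σ).get p = (σ v).get q
  | leaf (Sum.inl w), p, h => by
    simp only [param, Option.some.injEq, Prod.mk.injEq] at h
    obtain ⟨rfl, rfl⟩ := h
    simp [subst]
  | leaf (Sum.inr _), p, h => by simp [param] at h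
  | node c args, [], h => by simp [param] at h
  | node c args, i :: p, h => by
    simp only [param] at h
    split at h
    · rename_i hi
      simpa [subst, get, hi] using get_inst h
    · cases h

/-- On `Bool`, `==` is multiplication of signs with `true` as unit, so signs along a path multiply.
The path to the variable contributes the same sign at each of its occurrences, which leaves an
expression in `v` and `q` alone. -/
theorem sign_inst {pol : ℕ → Bool} {σ : ℕ → Structure L st} {v : ℕ} {q : List ℕ} :
    ∀ {b : Bool} {t : SStr L st} {p : List ℕ}, t.Pol pol b → t.param p = some (v, q) →
      (b == (t.inst σ).sign p) = (pol v == (σ v).sign q)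
  | b, leaf (Sum.inl w), p, hp, h => by
    simp only [param, Option.some.injEq, Prod.mk.injEq] at h
    obtain ⟨rfl, rfl⟩ := h
    simp only [Pol] at hp
    simp [subst, hp]
  | b, leaf (Sum.inr _), p, _, h => by simp [param] at h
  | b, node c args, [], _, h => by simp [param] at h
  | b, node c args, i :: p, hp, h => by
    simp only [param] at h
    split at h
    · rename_i hi
      rw [← sign_inst (hp ⟨i, hi⟩) h]
      simp only [subst, sign, hi, dif_pos]
      generalize c.ord _ = x
      generalize sign _ p = y
      cases b <;> cases x <;> cases y <;> rfl
    · cases h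

theorem mem_vars_of_param {v : ℕ} {q : List ℕ} :
    ∀ {t : SStr L st} {p : List ℕ}, t.param p = some (v, q) → v ∈ t.vars
  | leaf (Sum.inl w), p, h => by
    simp only [param, Option.some.injEq, Prod.mk.injEq] at h
    simp [vars, h.1]
  | leaf (Sum.inr _), p, h => by simp [param] at h
  | node c args, [], h => by simp [param] at h
  | node c args, i :: p, h => by
    simp only [param] at h
    split at h
    · exact Set.mem_iUnion.2 ⟨_, mem_vars_of_param h⟩
    · cases h

/-- Two paths that part at some node enter arguments with disjoint variables, so they cannot end
below the same variable. -/
theorem Linear.param_injective {x : ℕ × List ℕ} :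
    ∀ {t : SStr L st} {p p' : List ℕ}, t.Linear → t.param p = some x → t.param p' = some x → p = p'
  | leaf (Sum.inl w), p, p', _, h, h' => by
    simp only [param, Option.some.injEq] at h h'
    simpa using h.trans h'.symm
  | leaf (Sum.inr _), p, _, _, h, _ => by simp [param] at h
  | node c args, [], _, _, h, _ => by simp [param] at h
  | node c args, _ :: _, [], _, _, h => by simp [param] at h
  | node c args, i :: p, j :: p', hl, h, h' => by
    simp only [param] at h h'
    split at h
    · split at h'
      · rename_i hi hj
        by_cases hij : i = j
        · subst hij
          rw [(hl.1 _).param_injective h h']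
        · exact absurd (mem_vars_of_param h')
            (Set.disjoint_left.1 (hl.2 ⟨i, hi⟩ ⟨j, hj⟩ (by simpa using hij))
              (mem_vars_of_param h))
      · cases h'
    · cases h

theorem replace_empty {α : Type u} (Z : Str L α) : ∀ t : Str L α, t.replace ∅ Z = t
  | leaf a => by simp [replace]
  | node c args => by
    simp only [replace, Set.mem_empty_iff_false, if_false]
    congr 1
    funext i
    exact replace_empty Z (args i)

/-- All copies of `v` are altered at the same place `q`, which is the effect of altering the value
of `v`. This is the content of C₆ and C₇. -/
theorem replace_inst (σ : ℕ → Structure L st) (v : ℕ) (q : List ℕ) (Z : Structure L st) :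
    ∀ t : SStr L st, (t.inst σ).replace {p | t.param p = some (v, q)} Z =
      t.inst (Function.update σ v ((σ v).replace {q} Z))
  | leaf (Sum.inl w) => by
    by_cases hw : w = v
    · subst hw
      simp [subst, param]
    · simp [subst, param, hw, replace_empty]
  | leaf (Sum.inr A) => by simp [subst, param, replace]
  | node c args => by
    simp only [subst, replace, Set.mem_ofPred_eq, param, reduceCtorEq, if_false]
    congr 1
    funext i
    simp only [Fin.is_lt, dif_pos]
    exact replace_inst σ v q Z (args i)

/-- A formula that the scheme does not mention can only come from the value of a variable, so it is
a parameter and never principal. -/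
theorem Bare.get_inst_leaf {σ : ℕ → Structure L st} {A : Fm L st} :
    ∀ {t : SStr L st} {p : List ℕ}, t.Bare → (t.inst σ).get p = some A.str →
      ∃ v q, ((σ v).get q).isSome = true ∧ t.param p = some (v, q)
  | leaf (Sum.inl w), p, _, h => by
    simp only [subst, Sum.elim_inl] at h
    exact ⟨w, p, by simp [h], by simp [param]⟩
  | leaf (Sum.inr _), p, hb, _ => hb.elim
  | node c args, [], _, h => by simp [subst, get] at h
  | node c args, i :: p, hb, h => by
    simp only [subst, get] at h
    split at h
    · rename_i hi
      obtain ⟨v, q, h₁, h₂⟩ := (hb ⟨i, hi⟩).get_inst_leaf h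
      exact ⟨v, q, h₁, by simp [param, hi, h₂]⟩
    · cases h

theorem mem_leaves_inst {σ : ℕ → Structure L st} {A : Fm L st} :
    ∀ {t : SStr L st}, A ∈ (t.inst σ).leaves ↔
      (∃ v ∈ t.vars, A ∈ (σ v).leaves) ∨ Sum.inr A ∈ t.leaves
  | leaf (Sum.inl w) => by simp [subst, vars, leaves]
  | leaf (Sum.inr B) => by simp [subst, vars, leaves]
  | node c args => by
    simp only [subst, vars, leaves, Set.mem_iUnion, mem_leaves_inst]
    constructor
    · rintro ⟨i, ⟨v, h, h'⟩ | h⟩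
      · exact Or.inl ⟨v, ⟨i, h⟩, h'⟩
      · exact Or.inr ⟨i, h⟩
    · rintro (⟨v, ⟨i, h⟩, h'⟩ | ⟨i, h⟩)
      · exact ⟨i, Or.inl ⟨v, h, h'⟩⟩
      · exact ⟨i, Or.inr h⟩

theorem inst_congr {σ σ' : ℕ → Structure L st} :
    ∀ {t : SStr L st}, (∀ v ∈ t.vars, σ v = σ' v) → t.inst σ = t.inst σ'
  | leaf (Sum.inl w), h => by simpa [subst, vars] using h
  | leaf (Sum.inr B), _ => by simp [subst]
  | node c args, h => by
    simp only [subst]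
    congr 1
    funext i
    exact inst_congr fun v hv => h v (Set.mem_iUnion.2 ⟨i, hv⟩)

/-- The second structure arises from the first by replacing with `Z` some of the leaves `A` in the
position `d`, where the root has the position `b`. -/
inductive Repl (d : Bool) (A : Fm L st) (Z : Structure L st) :
    Bool → Structure L st → Structure L st → Prop
  | refl (b : Bool) (t : Structure L st) : Repl d A Z b t t
  | leaf : Repl d A Z d A.str Z
  | node (b : Bool) (c : SConn L) (t t' : Fin c.arity → Structure L st) :
      (∀ i, Repl d A Z (b == c.ord i) (t i) (t' i)) → Repl d A Z b (node c t) (node c t')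

/-- This carries a replacement from the conclusion of a rule to its premises. A variable may be
repeated here, as in contraction: `Pol` puts all its copies in the same position, so the same change
is admissible in each. -/
theorem Repl.inst {d : Bool} {A : Fm L st} {Z : Structure L st} {pol : ℕ → Bool}
    {σ σ' : ℕ → Structure L st} (hσ : ∀ v, Repl d A Z (pol v) (σ v) (σ' v)) :
    ∀ {b : Bool} {t : SStr L st}, t.Pol pol b → Repl d A Z b (t.inst σ) (t.inst σ')
  | b, .leaf (Sum.inl w), h => by
    simp only [Pol] at h
    simpa [subst, ← h] using hσ w
  | b, .leaf (Sum.inr _), _ => Repl.refl _ _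
  | b, .node c args, h => Repl.node _ _ _ _ fun i => Repl.inst hσ (h i)

/-- A replacement in an instance of a linear schematic structure without formulas is a replacement
in the structures assigned to the structure variables. -/
theorem Repl.exists_of_inst {d : Bool} {A : Fm L st} {Z : Structure L st} {pol : ℕ → Bool}
    {σ : ℕ → Structure L st} :
    ∀ {b : Bool} {t : SStr L st} {u : Structure L st}, t.Pol pol b → t.Linear → t.Bare →
      Repl d A Z b (t.inst σ) u →
      ∃ σ' : ℕ → Structure L st, u = t.inst σ' ∧ ∀ v, Repl d A Z (pol v) (σ v) (σ' v)
  | b, .leaf (Sum.inl w), u, hp, _, _, h => by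
    simp only [Pol] at hp
    subst hp
    refine ⟨Function.update σ w u, by simp [subst], fun v => ?_⟩
    by_cases hv : v = w
    · subst hv
      simpa [subst] using h
    · simpa [hv] using Repl.refl _ _
  | b, .leaf (Sum.inr _), u, _, _, hb, _ => hb.elim
  | b, .node c args, u, hp, hl, hb, h => by
    have key : ∃ t' : Fin c.arity → Structure L st, u = .node c t' ∧
        ∀ i, Repl d A Z (b == c.ord i) ((args i).inst σ) (t' i) := by
      generalize hs : (Str.node c args).inst σ = s at h
      cases h with
      | refl => exact ⟨fun i => (args i).inst σ, hs.symm, fun i => Repl.refl _ _⟩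
      | leaf => simp [subst] at hs
      | node _ c' t t' h =>
        simp only [subst, Str.node.injEq] at hs
        obtain ⟨rfl, hs⟩ := hs
        obtain rfl := eq_of_heq hs
        exact ⟨t', rfl, h⟩
    obtain ⟨t', rfl, ht'⟩ := key
    choose τ hτ hτ' using fun i => Repl.exists_of_inst (hp i) (hl.1 i) (hb i) (ht' i)
    classical
    -- The assignments found for the separate arguments are glued; by linearity a variable belongs
    -- to at most one argument, so the choice of that argument is harmless.
    refine ⟨fun v => if h : ∃ i, v ∈ (args i).vars then τ h.choose v else σ v, ?_, fun v => ?_⟩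
    · simp only [subst]
      congr 1
      funext i
      rw [hτ i]
      refine inst_congr fun v hv => ?_
      have h : ∃ i, v ∈ (args i).vars := ⟨i, hv⟩
      rw [dif_pos h]
      by_contra hne
      have : i ≠ h.choose := fun e => hne (by rw [← e])
      exact Set.disjoint_left.1 (hl.2 _ _ this) hv h.choose_spec
    · dsimp only
      split
      · exact hτ' _ v
      · exact Repl.refl _ _

end Str

/-- The sequent with `T` on the side `d` and `U` on the other side. -/
def Seq.dir {α : Type u} (d : Bool) (T U : Str L α) : Seq L α := if d then ⟨T, U⟩ else ⟨U, T⟩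

theorem Seq.dir_not {α : Type u} (d : Bool) (T U : Str L α) :
    Seq.dir (!d) T U = Seq.dir d U T := by
  cases d <;> rfl

theorem Seq.dir_side {α : Type u} (d : Bool) (s : Seq L α) :
    Seq.dir d (s.side d) (s.side !d) = s := by
  cases d <;> rfl

/-- Instantiation of the structure variables. -/
abbrev Seq.inst (s : SSeq L st) (σ : ℕ → Structure L st) : Sequent L st :=
  s.subst (Sum.elim (fun v => σ v) Str.leaf)

theorem Seq.inst_side (s : SSeq L st) (σ : ℕ → Structure L st) (b : Bool) :
    (s.inst σ).side b = (s.side b).inst σ := by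
  cases b <;> rfl

/-- The syntactic conditions on a schematic rule that guarantee `C₂`–`C₇`. -/
structure Scheme.Regular (r : Scheme L st) : Prop where
  pol : ∃ pol : ℕ → Bool, ∀ l b, ((r.seq l).side b).Pol pol b
  linear : ∀ b, ((r.seq none).side b).Linear
  disjoint : Disjoint (r.seq none).ante.vars (r.seq none).succ.vars
  display : ∀ b, ((r.seq none).side b).Bare ∨ ∃ A, (r.seq none).side b = sf A

/-- The structure variables of `t` occur in `c`, and the formulas of `t` are subformulas of formulas
of `c`. -/
def Seq.Covers (c : SSeq L st) (t : SStr L st) : Prop :=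
  (∀ v ∈ t.vars, ∃ b, v ∈ (c.side b).vars) ∧
    ∀ A, Sum.inr A ∈ t.leaves → ∃ b B, Sum.inr B ∈ (c.side b).leaves ∧ Sub A B

/-- The syntactic condition on a schematic rule that guarantees `C₁`. -/
def Scheme.Analytic (r : Scheme L st) : Prop :=
  ∀ i b, (r.seq none).Covers ((r.seq (some i)).side b)

/-! ### Conditions C₁–C₇ for a single schematic rule -/

namespace Scheme

variable {r : Scheme L st}

theorem inst_side (σ : ℕ → Structure L st) (l : Option (Fin r.k)) (b : Bool) :
    ((r.inst σ).seq l).side b = ((r.seq l).side b).inst σ :=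
  Seq.inst_side _ _ _

theorem c2 (σ : ℕ → Structure L st) {o o' : Occ r.k} (h : (r.inst σ).cong o o') :
    ∃ X, (r.inst σ).sub o = some X ∧ (r.inst σ).sub o' = some X := by
  obtain ⟨v, q, h₁, h₂, h₃⟩ := h
  obtain ⟨X, hX⟩ := Option.isSome_iff_exists.1 h₁
  refine ⟨X, ?_, ?_⟩
  · rw [Application.sub, inst_side, Str.get_inst h₂, hX]
  · rw [Application.sub, inst_side, Str.get_inst h₃, hX]

/-- Both nodes lie below the same variable of the conclusion. Disjointness of the two sides forces
them onto one side, and linearity of that side forces equal paths. -/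
theorem Regular.c3 (hr : r.Regular) (σ : ℕ → Structure L st) {o o₁ o₂ : Occ r.k}
    (h₁ : o₁.loc = none) (h₂ : o₂.loc = none) (h : (r.inst σ).cong o o₁)
    (h' : (r.inst σ).cong o o₂) : o₁ = o₂ := by
  obtain ⟨v, q, -, e₁, e₂⟩ := (r.inst σ).cong_trans _ _ _ ((r.inst σ).cong_symm _ _ h) h'
  obtain ⟨l₁, b₁, p₁⟩ := o₁
  obtain ⟨l₂, b₂, p₂⟩ := o₂
  dsimp only at h₁ h₂ e₁ e₂
  subst h₁ h₂
  have hd := Set.disjoint_left.1 hr.disjoint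
  have m₁ := Str.mem_vars_of_param e₁
  have m₂ := Str.mem_vars_of_param e₂
  have hb : b₁ = b₂ := by
    cases b₁ <;> cases b₂
    · rfl
    · exact (hd m₂ m₁).elim
    · exact (hd m₁ m₂).elim
    · rfl
  subst hb
  rw [(hr.linear b₁).param_injective e₁ e₂]

theorem Regular.c4 (hr : r.Regular) (σ : ℕ → Structure L st) {o o' : Occ r.k}
    (h : (r.inst σ).cong o o') : (r.inst σ).Precedent o ↔ (r.inst σ).Precedent o' := by
  obtain ⟨v, q, -, h₁, h₂⟩ := h
  obtain ⟨pol, hpol⟩ := hr.pol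
  have key : ∀ o : Occ r.k, ((r.seq o.loc).side o.ante).param o.path = some (v, q) →
      ((r.inst σ).Precedent o ↔ (pol v == (σ v).sign q) = true) := by
    intro o h
    rw [Application.Precedent, inst_side, ← Str.sign_inst (hpol o.loc o.ante) h, beq_iff_eq,
      eq_comm]
  rw [key o h₁, key o' h₂]

theorem Regular.c5 (hr : r.Regular) (σ : ℕ → Structure L st) {o : Occ r.k} {A : Fm L st}
    (h : (r.inst σ).IsPrincipal o A) : o.path = [] := by
  obtain ⟨l, b, p⟩ := o
  obtain ⟨rfl : l = none, h₂, h₃⟩ := h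
  rw [Application.sub, inst_side] at h₂
  dsimp only at h₂ ⊢
  rcases hr.display b with hb | ⟨B, hB⟩
  · obtain ⟨v, q, h₄, h₅⟩ := hb.get_inst_leaf h₂
    exact (h₃ ⟨v, q, h₄, h₅, h₅⟩).elim
  · rw [hB] at h₂
    cases p with
    | nil => rfl
    | cons i p => simp [sf, Str.subst, Str.get] at h₂

/-- The congruence class of a parameter is determined by its variable and its place in the value, so
modifying that single value performs the replacement in all sequents at once. Neither regularity nor
the position of the parameter matters. -/
theorem exists_inst_replaceSeq (σ : ℕ → Structure L st) {o : Occ r.k} (h : (r.inst σ).IsParam o)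
    (Z : Structure L st) : ∃ σ', ∀ l, (r.inst σ').seq l = (r.inst σ).replaceSeq o Z l := by
  obtain ⟨v, q, h₁, h₂, -⟩ := h
  have key : ∀ o', (r.inst σ).cong o o' ↔
      ((r.seq o'.loc).side o'.ante).param o'.path = some (v, q) := by
    refine fun o' => ⟨?_, fun h => ⟨v, q, h₁, h₂, h⟩⟩
    rintro ⟨v', q', -, h₃, h₄⟩
    obtain ⟨rfl, rfl⟩ := Prod.mk.inj (Option.some.inj (h₂.symm.trans h₃))
    exact h₄
  refine ⟨Function.update σ v ((σ v).replace {q} Z), fun l => ?_⟩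
  simp only [Application.replaceSeq, key]
  exact congrArg₂ Seq.mk (Str.replace_inst σ v q Z (r.seq l).ante).symm
    (Str.replace_inst σ v q Z (r.seq l).succ).symm

theorem Analytic.c1 (hr : r.Analytic) (σ : ℕ → Structure L st) (i : Fin r.k) {A : Fm L st}
    (hA : A ∈ ((r.inst σ).seq (some i)).leaves) :
    ∃ B ∈ ((r.inst σ).seq none).leaves, Sub A B := by
  have mem : ∀ l A, A ∈ ((r.inst σ).seq l).leaves ↔
      ∃ b, A ∈ (((r.seq l).side b).inst σ).leaves := by
    intro l A
    simp only [← inst_side, Bool.exists_bool]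
    exact or_comm
  simp only [mem, Str.mem_leaves_inst] at hA ⊢
  obtain ⟨b, ⟨v, hv, hA⟩ | hA⟩ := hA
  · obtain ⟨b', hb'⟩ := (hr i b).1 v hv
    exact ⟨A, ⟨b', Or.inl ⟨v, hb', hA⟩⟩, Sub.refl A⟩
  · obtain ⟨b', B, hB, hs⟩ := (hr i b).2 A hA
    exact ⟨B, ⟨b', Or.inr hB⟩, hs⟩

/-- If the side were a structure variable, its root would be a parameter; if it were a compound
structure, its instance would not be a formula. -/
theorem side_eq_of_isPrincipal (σ : ℕ → Structure L st) {b : Bool} {A : Fm L st}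
    (h : (r.inst σ).IsPrincipal ⟨none, b, []⟩ A) : (r.seq none).side b = sf A := by
  obtain ⟨-, h₂, h₃⟩ := h
  rw [Application.sub, inst_side] at h₂
  simp only [Application.IsParam, inst] at h₃
  dsimp only at h₂
  generalize (r.seq none).side b = t at h₂ h₃ ⊢
  match t with
  | .leaf (Sum.inl v) => exact (h₃ ⟨v, [], by simp [Str.get], by simp [Str.param]⟩).elim
  | .leaf (Sum.inr B) =>
    simp only [Str.subst, Str.get, Sum.elim_inr, Option.some.injEq, Str.leaf.injEq] at h₂
    rw [h₂, sf]
  | .node c args => simp [Str.subst, Str.get] at h₂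

end Scheme

/-! ### Derivability -/

/-- The calculus given by a set of schematic rules. -/
def schematic (𝓡 : Set (Scheme L st)) : Calculus L st := {R | ∃ r ∈ 𝓡, R = r.toRule}

/-- Derivability by schematic rules from the hypotheses `Hy`, with cut formulas in `P`, and such that
all formulas that occur are in `Q`. -/
inductive Der (𝓡 : Set (Scheme L st)) (Hy : Set (Sequent L st)) (P Q : Set (Fm L st)) :
    Sequent L st → Prop
  | hyp {s : Sequent L st} (h : s ∈ Hy) (hQ : s.leaves ⊆ Q) : Der 𝓡 Hy P Q s
  | rule (r : Scheme L st) (hr : r ∈ 𝓡) (σ : ℕ → Structure L st)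
      (hQ : ((r.seq none).inst σ).leaves ⊆ Q)
      (d : ∀ i, Der 𝓡 Hy P Q ((r.seq (some i)).inst σ)) : Der 𝓡 Hy P Q ((r.seq none).inst σ)
  | cut {X Y : Structure L st} (A : Fm L st) (hA : A ∈ P)
      (hQ : (⟨X, Y⟩ : Sequent L st).leaves ⊆ Q)
      (d₁ : Der 𝓡 Hy P Q ⟨X, A.str⟩) (d₂ : Der 𝓡 Hy P Q ⟨A.str, Y⟩) : Der 𝓡 Hy P Q ⟨X, Y⟩

namespace Der

variable {𝓡 : Set (Scheme L st)} {Hy : Set (Sequent L st)} {P Q : Set (Fm L st)}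

theorem exists_derivation {s : Sequent L st} (h : Der 𝓡 Hy P Q s) :
    ∃ d : Derivation (schematic 𝓡) Hy s, d.cuts ⊆ P ∧ d.formulas ⊆ Q := by
  induction h with
  | hyp h hQ => exact ⟨.hyp h, by simp [Derivation.cuts], hQ⟩
  | rule r hr σ hQ _ ih =>
    choose d hP hQ' using ih
    have hR : r.toRule ∈ schematic 𝓡 := ⟨r, hr, rfl⟩
    have ha : r.inst σ ∈ r.toRule.apps := ⟨σ, rfl⟩
    refine ⟨.rule r.toRule hR (r.inst σ) ha d, ?_, ?_⟩
    · exact Set.iUnion_subset hP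
    · exact Set.union_subset hQ (Set.iUnion_subset hQ')
  | cut A hA hQ _ _ ih₁ ih₂ =>
    obtain ⟨d₁, h₁, h₁'⟩ := ih₁
    obtain ⟨d₂, h₂, h₂'⟩ := ih₂
    refine ⟨.cut A d₁ d₂, ?_, ?_⟩
    · exact Set.union_subset (Set.singleton_subset_iff.2 hA) (Set.union_subset h₁ h₂)
    · exact Set.union_subset hQ (Set.union_subset h₁' h₂')

theorem of_derivation {s : Sequent L st} (d : Derivation (schematic 𝓡) Hy s) :
    Der 𝓡 Hy Set.univ Set.univ s := by
  induction d with
  | hyp h => exact .hyp h (Set.subset_univ _)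
  | rule R hR a ha _ ih =>
    obtain ⟨r, hr, rfl⟩ := hR
    obtain ⟨σ, rfl⟩ := ha
    exact .rule r hr σ (Set.subset_univ _) ih
  | cut A _ _ ih₁ ih₂ => exact .cut A trivial (Set.subset_univ _) ih₁ ih₂

/-- A derivation in an analytic calculus contains only subformulas of its last sequent and of cut
formulas. -/
theorem restrict (h𝓡 : ∀ r ∈ 𝓡, r.Analytic) (hQ : ∀ A B, Sub A B → B ∈ Q → A ∈ Q)
    {s : Sequent L st} (h : Der 𝓡 ∅ ∅ Set.univ s) (hs : s.leaves ⊆ Q) : Der 𝓡 ∅ ∅ Q s := by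
  induction h with
  | hyp h => exact h.elim
  | rule r hr σ _ _ ih =>
    refine .rule r hr σ hs fun i => ih i fun A hA => ?_
    obtain ⟨B, hB, hAB⟩ := (h𝓡 r hr).c1 σ i hA
    exact hQ A B hAB (hs hB)
  | cut A hA => exact hA.elim

end Der

theorem Sub.trans {A B C : Fm L st} (h : Sub A B) (h' : Sub B C) : Sub A C := by
  induction h' with
  | refl => exact h
  | arg c D i _ ih => exact Sub.arg c D i ih

/-- Induction on proper subformulas. -/
theorem Fm.sub_induction {p : Fm L st → Prop}
    (h : ∀ A, (∀ B, Sub B A → B ≠ A → p B) → p A) (A : Fm L st) : p A := by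
  suffices ∀ A B : Fm L st, Sub B A → p B from this A A (Sub.refl A)
  intro A
  induction A with
  | atom q =>
    intro B hB
    cases hB
    refine h _ fun C hC hne => ?_
    cases hC
    exact (hne rfl).elim
  | app c args ih =>
    intro B hB
    cases hB with
    | refl =>
      refine h _ fun C hC hne => ?_
      cases hC with
      | refl => exact (hne rfl).elim
      | arg _ _ i hi => exact ih i C hi
    | arg _ _ i hi => exact ih i B hi

/-- Formulas are well-founded: if `A i` were `c(A)` itself, the same equation would hold at this
argument, contradicting the induction hypothesis there. -/
theorem Fm.arg_ne_app (c : OConn L st) (A : Fin c.toS.arity → Fm L st) (i : Fin c.toS.arity) :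
    A i ≠ .app c A := by
  suffices ∀ B : Fm L st, B = .app c A → A i ≠ B from this _ rfl
  intro B
  induction B with
  | atom p => intro h; cases h
  | app c' A' ih =>
    intro h h'
    cases h
    exact ih i h' rfl

/-! ### Cut elimination -/

/-- Eliminability of matching principal constituents for schematic rules. -/
def PrincipalCut (𝓡 : Set (Scheme L st)) : Prop :=
  ∀ r₁ ∈ 𝓡, ∀ r₂ ∈ 𝓡, ∀ (σ₁ σ₂ : ℕ → Structure L st) (A : Fm L st),
    (r₁.seq none).succ = sf A → (r₂.seq none).ante = sf A →
    Der 𝓡 ((Set.range fun i => (r₁.seq (some i)).inst σ₁) ∪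
      (Set.range fun i => (r₂.seq (some i)).inst σ₂)) {B | Sub B A ∧ B ≠ A} Set.univ
      ⟨(r₁.seq none).ante.inst σ₁, (r₂.seq none).succ.inst σ₂⟩

namespace Der

variable {𝓡 : Set (Scheme L st)} {Hy : Set (Sequent L st)} {P Q : Set (Fm L st)}

/-- If `A` can be replaced with `Z` on the side `d` where it is principal, then occurrences of `A`
in the position `d` can be replaced with `Z` in every derivable sequent. -/
theorem repl (h𝓡 : ∀ r ∈ 𝓡, r.Regular) {d : Bool} {A : Fm L st} {Z : Structure L st}
    (hprin : ∀ r ∈ 𝓡, ∀ σ : ℕ → Structure L st, (r.seq none).side d = sf A →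
      (∀ i, Der 𝓡 ∅ ∅ Set.univ ((r.seq (some i)).inst σ)) →
      Der 𝓡 ∅ ∅ Set.univ (Seq.dir d Z (((r.seq none).side (!d)).inst σ)))
    {s : Sequent L st} (h : Der 𝓡 ∅ ∅ Set.univ s) :
    ∀ s' : Sequent L st, (∀ b, Str.Repl d A Z b (s.side b) (s'.side b)) →
      Der 𝓡 ∅ ∅ Set.univ s' := by
  induction h with
  | hyp h => exact h.elim
  | cut A hA => exact hA.elim
  | rule r hr σ _ _ ih =>
    intro s' hs'
    obtain ⟨pol, hpol⟩ := (h𝓡 r hr).pol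
    -- On each side of the conclusion, either the replacement happens inside the values of
    -- variables, or the side is the formula `A` itself, standing in the scheme, and it is replaced
    -- as a whole. The latter is possible only on the side `d`.
    have one : ∀ b, ∃ σ' : ℕ → Structure L st, (∀ v, Str.Repl d A Z (pol v) (σ v) (σ' v)) ∧
        (s'.side b = ((r.seq none).side b).inst σ' ∨
          b = d ∧ (r.seq none).side b = sf A ∧ s'.side b = Z) := by
      intro b
      have hb := hs' b
      rw [Seq.inst_side] at hb
      rcases (h𝓡 r hr).display b with hbare | ⟨B, hB⟩
      · obtain ⟨σ', h₁, h₂⟩ :=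
          Str.Repl.exists_of_inst (hpol none b) ((h𝓡 r hr).linear b) hbare hb
        exact ⟨σ', h₂, Or.inl h₁⟩
      · refine ⟨σ, fun v => .refl _ _, ?_⟩
        rw [hB] at hb ⊢
        generalize hu : s'.side b = u at hb
        generalize ht : (sf B).inst σ = t at hb
        cases hb with
        | refl => exact Or.inl rfl
        | leaf =>
          simp only [sf, Str.subst, Sum.elim_inr, Str.leaf.injEq] at ht
          exact Or.inr ⟨rfl, by rw [ht], rfl⟩
        | node => simp [sf, Str.subst] at ht
    obtain ⟨τ, hτ, hτ'⟩ := one true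
    obtain ⟨ρ, hρ, hρ'⟩ := one false
    have both : ∃ σ' : ℕ → Structure L st, (∀ v, Str.Repl d A Z (pol v) (σ v) (σ' v)) ∧
        ∀ b, (s'.side b = ((r.seq none).side b).inst σ' ∨
          b = d ∧ (r.seq none).side b = sf A ∧ s'.side b = Z) := by
      classical
      -- The two sides of the conclusion share no variable, so their assignments combine. Variables
      -- that occur in premises only receive a value from `ρ`, which is again a legitimate
      -- replacement.
      refine ⟨fun v => if v ∈ (r.seq none).ante.vars then τ v else ρ v, fun v => ?_, ?_⟩
      · dsimp only
        split
        · exact hτ v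
        · exact hρ v
      · rintro (_ | _)
        · refine hρ'.imp_left fun h => h.trans (Str.inst_congr fun v hv => ?_)
          rw [if_neg (Set.disjoint_right.1 (h𝓡 r hr).disjoint hv)]
        · refine hτ'.imp_left fun h => h.trans (Str.inst_congr fun v hv => ?_)
          exact (if_pos hv).symm
    obtain ⟨σ', hσ', h'⟩ := both
    have prem : ∀ i, Der 𝓡 ∅ ∅ Set.univ ((r.seq (some i)).inst σ') := by
      refine fun i => ih i _ fun b => ?_
      rw [Seq.inst_side, Seq.inst_side]
      exact Str.Repl.inst hσ' (hpol (some i) b)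
    have h'd : s'.side (!d) = ((r.seq none).side (!d)).inst σ' := by
      rcases h' (!d) with h | ⟨h, -⟩
      · exact h
      · cases d <;> cases h
    rcases h' d with h | ⟨-, h₁, h₂⟩
    · have : s' = (r.seq none).inst σ' := by
        rw [← Seq.dir_side d s', h, h'd, ← Seq.inst_side, ← Seq.inst_side, Seq.dir_side]
      rw [this]
      exact .rule r hr σ' (Set.subset_univ _) prem
    -- The occurrence was introduced by this very rule. The other replacements are already made in
    -- `σ'`, and the remaining one is the assumption on principal occurrences.
    · rw [← Seq.dir_side d s', h₂, h'd]
      exact hprin r hr σ' h₁ prem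

/-- Cut-free derivations of the hypotheses are grafted onto the leaves, and each cut is removed on
the way down by admissibility for its formula. -/
theorem elim_hyp {s : Sequent L st} (h : Der 𝓡 Hy P Set.univ s)
    (hHy : ∀ s ∈ Hy, Der 𝓡 ∅ ∅ Set.univ s)
    (hP : ∀ A ∈ P, ∀ X Y, Der 𝓡 ∅ ∅ Set.univ ⟨X, A.str⟩ → Der 𝓡 ∅ ∅ Set.univ ⟨A.str, Y⟩ →
      Der 𝓡 ∅ ∅ Set.univ ⟨X, Y⟩) : Der 𝓡 ∅ ∅ Set.univ s := by
  induction h with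
  | hyp h => exact hHy _ h
  | rule r hr σ hQ _ ih => exact .rule r hr σ hQ ih
  | cut A hA _ _ _ ih₁ ih₂ => exact hP A hA _ _ ih₁ ih₂

/-- The only measure is the cut formula. No induction on the height of derivations is needed beyond
the one inside `repl`, since all traced occurrences of `A` are replaced simultaneously. -/
theorem cut_admissible (h𝓡 : ∀ r ∈ 𝓡, r.Regular) (hcut : PrincipalCut 𝓡) (A : Fm L st) :
    ∀ X Y, Der 𝓡 ∅ ∅ Set.univ ⟨X, A.str⟩ → Der 𝓡 ∅ ∅ Set.univ ⟨A.str, Y⟩ →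
      Der 𝓡 ∅ ∅ Set.univ ⟨X, Y⟩ := by
  induction A using Fm.sub_induction with
  | h A ih =>
    intro X Y hX hY
    refine repl h𝓡 (d := false) (A := A) (Z := Y) ?_ hX _ ?_
    · intro r₁ hr₁ σ₁ e₁ d₁
      -- Now `A` is principal on the right in an application of `r₁`. The antecedent of that
      -- application takes the place of `A` in the derivation of `A ⊢ Y`, and the values in `σ₁`
      -- already contain the replacements by `Y` made above it.
      refine repl h𝓡 (d := true) (A := A) (Z := (r₁.seq none).ante.inst σ₁) ?_ hY _ ?_
      · intro r₂ hr₂ σ₂ e₂ d₂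
        -- Here `A` is principal on both sides. The reduction uses the premises of the two rules,
        -- which are derived without cut, and cuts on proper subformulas, which the induction
        -- hypothesis removes.
        refine (hcut r₁ hr₁ r₂ hr₂ σ₁ σ₂ A e₁ e₂).elim_hyp ?_ fun B hB => ih B hB.1 hB.2
        rintro _ (⟨i, rfl⟩ | ⟨i, rfl⟩)
        · exact d₁ i
        · exact d₂ i
      · rintro (_ | _)
        · exact .refl _ _
        · exact .leaf
    · rintro (_ | _)
      · exact .leaf
      · exact .refl _ _

theorem cut_elimination (h𝓡 : ∀ r ∈ 𝓡, r.Regular) (hcut : PrincipalCut 𝓡) {s : Sequent L st}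
    (h : Der 𝓡 ∅ P Set.univ s) : Der 𝓡 ∅ ∅ Set.univ s :=
  h.elim_hyp (fun _ h => h.elim) fun A _ => cut_admissible h𝓡 hcut A

end Der

/-! ### Computation rules for the binary structural connectives -/

namespace Str

section

variable {α : Type u}

theorem node_semi (X : Fin 2 → Str L α) : node (L := L) .semi X = (X 0).semi (X 1) :=
  congrArg (node .semi) (funext (Fin.forall_fin_two.2 ⟨rfl, rfl⟩))

theorem node_gt (X : Fin 2 → Str L α) : node (L := L) .gt X = (X 0).gt (X 1) :=
  congrArg (node .gt) (funext (Fin.forall_fin_two.2 ⟨rfl, rfl⟩))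

theorem node_lt (X : Fin 2 → Str L α) : node (L := L) .lt X = (X 0).lt (X 1) :=
  congrArg (node .lt) (funext (Fin.forall_fin_two.2 ⟨rfl, rfl⟩))

theorem leaves_semi (X Y : Str L α) : (X.semi Y).leaves = X.leaves ∪ Y.leaves := by
  ext a
  exact Set.mem_iUnion.trans Fin.exists_fin_two

theorem leaves_gt (X Y : Str L α) : (X.gt Y).leaves = X.leaves ∪ Y.leaves := by
  ext a
  exact Set.mem_iUnion.trans Fin.exists_fin_two

theorem leaves_lt (X Y : Str L α) : (X.lt Y).leaves = X.leaves ∪ Y.leaves := by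
  ext a
  exact Set.mem_iUnion.trans Fin.exists_fin_two

end

variable {pol : ℕ → Bool} {b : Bool} {X Y : SStr L st} {σ : ℕ → Structure L st}

theorem inst_I : (I : SStr L st).inst σ = I := congrArg (node .I) (funext fun i => Fin.elim0 i)

theorem inst_semi : (X.semi Y).inst σ = (X.inst σ).semi (Y.inst σ) :=
  congrArg (node .semi) (funext (Fin.forall_fin_two.2 ⟨rfl, rfl⟩))

theorem inst_gt : (X.gt Y).inst σ = (X.inst σ).gt (Y.inst σ) :=
  congrArg (node .gt) (funext (Fin.forall_fin_two.2 ⟨rfl, rfl⟩))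

theorem inst_lt : (X.lt Y).inst σ = (X.inst σ).lt (Y.inst σ) :=
  congrArg (node .lt) (funext (Fin.forall_fin_two.2 ⟨rfl, rfl⟩))

theorem inst_sv (n : ℕ) : (sv n : SStr L st).inst σ = σ n := rfl

theorem pol_I : (I : SStr L st).Pol pol b := fun i => Fin.elim0 i

theorem pol_semi : (X.semi Y).Pol pol b ↔ X.Pol pol b ∧ Y.Pol pol b := by
  cases b <;> exact Fin.forall_fin_two

theorem pol_gt : (X.gt Y).Pol pol b ↔ X.Pol pol (!b) ∧ Y.Pol pol b := by
  cases b <;> exact Fin.forall_fin_two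

theorem pol_lt : (X.lt Y).Pol pol b ↔ X.Pol pol b ∧ Y.Pol pol (!b) := by
  cases b <;> exact Fin.forall_fin_two

theorem pol_sv {n : ℕ} : (sv n : SStr L st).Pol pol b ↔ pol n = b := Iff.rfl

theorem vars_I : (I : SStr L st).vars = ∅ := Set.iUnion_eq_empty.2 fun i => Fin.elim0 i

theorem vars_semi : (X.semi Y).vars = X.vars ∪ Y.vars := by
  ext a
  exact Set.mem_iUnion.trans Fin.exists_fin_two

theorem vars_gt : (X.gt Y).vars = X.vars ∪ Y.vars := by
  ext a
  exact Set.mem_iUnion.trans Fin.exists_fin_two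

theorem vars_lt : (X.lt Y).vars = X.vars ∪ Y.vars := by
  ext a
  exact Set.mem_iUnion.trans Fin.exists_fin_two

theorem vars_sv {n : ℕ} : (sv n : SStr L st).vars = {n} := rfl

theorem bare_I : (I : SStr L st).Bare := fun i => Fin.elim0 i

theorem bare_semi : (X.semi Y).Bare ↔ X.Bare ∧ Y.Bare := Fin.forall_fin_two

theorem bare_gt : (X.gt Y).Bare ↔ X.Bare ∧ Y.Bare := Fin.forall_fin_two

theorem bare_lt : (X.lt Y).Bare ↔ X.Bare ∧ Y.Bare := Fin.forall_fin_two

theorem bare_sv {n : ℕ} : (sv n : SStr L st).Bare := trivial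

theorem linear_I : (I : SStr L st).Linear := ⟨fun i => Fin.elim0 i, fun i => Fin.elim0 i⟩

/-- The arity is kept as a variable until `subst`, so that the statement about pairs of arguments
becomes one about `Fin 2`. -/
theorem linear_two (c : SConn L) (h : c.arity = 2) (Z : Fin c.arity → SStr L st) :
    (node c Z).Linear ↔ (Z (Fin.cast h.symm 0)).Linear ∧ (Z (Fin.cast h.symm 1)).Linear ∧
      Disjoint (Z (Fin.cast h.symm 0)).vars (Z (Fin.cast h.symm 1)).vars := by
  simp only [Linear]
  generalize c.arity = n at h Z
  subst h
  simp only [Fin.forall_fin_two, Fin.cast_eq_self]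
  constructor
  · rintro ⟨⟨h₀, h₁⟩, ⟨-, h⟩, -⟩
    exact ⟨h₀, h₁, h Fin.zero_ne_one⟩
  · rintro ⟨h₀, h₁, h⟩
    exact ⟨⟨h₀, h₁⟩, ⟨fun h => (h rfl).elim, fun _ => h⟩, fun _ => h.symm, fun h => (h rfl).elim⟩

theorem linear_semi :
    (X.semi Y).Linear ↔ X.Linear ∧ Y.Linear ∧ Disjoint X.vars Y.vars := linear_two .semi rfl _

theorem linear_gt :
    (X.gt Y).Linear ↔ X.Linear ∧ Y.Linear ∧ Disjoint X.vars Y.vars := linear_two .gt rfl _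

theorem linear_lt :
    (X.lt Y).Linear ↔ X.Linear ∧ Y.Linear ∧ Disjoint X.vars Y.vars := linear_two .lt rfl _

theorem linear_sv {n : ℕ} : (sv n : SStr L st).Linear := trivial

theorem Bare.not_mem_leaves {A : Fm L st} : ∀ {t : SStr L st}, t.Bare → Sum.inr A ∉ t.leaves
  | leaf (Sum.inl _), _ => by simp [leaves]
  | leaf (Sum.inr _), h => h.elim
  | node _ _, h => by
    simp only [leaves, Set.mem_iUnion, not_exists]
    exact fun i => (h i).not_mem_leaves

end Str

/-! ### Sequents of a given direction -/

theorem dirSeq_not (b : Bool) (X Y : SStr L st) : dirSeq (!b) X Y = dirSeq b Y X := by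
  cases b <;> rfl

theorem dirSeq_inst (b : Bool) (X Y : SStr L st) (σ : ℕ → Structure L st) :
    (dirSeq b X Y).inst σ = Seq.dir b (X.inst σ) (Y.inst σ) := by
  cases b <;> rfl

theorem forall_side {p : Bool → SStr L st → Prop} {s : SSeq L st} :
    (∀ b, p b (s.side b)) ↔ p true s.ante ∧ p false s.succ := by
  rw [Bool.forall_bool]
  exact and_comm

theorem forall_side_dirSeq {p : Bool → SStr L st → Prop} {b : Bool} {X Y : SStr L st} :
    (∀ b', p b' ((dirSeq b X Y).side b')) ↔ p b X ∧ p (!b) Y := by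
  rw [forall_side]
  cases b
  · exact and_comm
  · exact Iff.rfl

/-- The structure variables of a schematic sequent. -/
def Seq.vars (s : SSeq L st) : Set ℕ := s.ante.vars ∪ s.succ.vars

theorem Seq.mem_vars {s : SSeq L st} {v : ℕ} : v ∈ s.vars ↔ ∃ b, v ∈ (s.side b).vars := by
  rw [Bool.exists_bool]
  exact or_comm

theorem vars_dirSeq (b : Bool) (X Y : SStr L st) : (dirSeq b X Y).vars = X.vars ∪ Y.vars := by
  cases b
  · exact Set.union_comm _ _
  · rfl

theorem disjoint_dirSeq {b : Bool} {X Y : SStr L st} (h : Disjoint X.vars Y.vars) :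
    Disjoint (dirSeq b X Y).ante.vars (dirSeq b X Y).succ.vars := by
  cases b
  · exact h.symm
  · exact h

/-- The premise `p` and the conclusion `c` of a structural rule all whose parameters are in the
conclusion. -/
structure Structural (p c : SSeq L st) : Prop where
  pol : ∃ pol : ℕ → Bool, (∀ b, (p.side b).Pol pol b) ∧ ∀ b, (c.side b).Pol pol b
  bare_left : ∀ b, (p.side b).Bare
  bare_right : ∀ b, (c.side b).Bare
  linear : ∀ b, (c.side b).Linear
  disjoint : Disjoint c.ante.vars c.succ.vars
  vars_subset : p.vars ⊆ c.vars

theorem Structural.regular {p c : SSeq L st} (h : Structural p c) :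
    (Scheme.unary p c).Regular where
  pol := by
    obtain ⟨pol, h₁, h₂⟩ := h.pol
    refine ⟨pol, ?_⟩
    rintro (_ | i)
    · exact h₂
    · exact h₁
  linear := h.linear
  disjoint := h.disjoint
  display b := Or.inl (h.bare_right b)

theorem Structural.analytic {p c : SSeq L st} (h : Structural p c) :
    (Scheme.unary p c).Analytic := fun _ b =>
  ⟨fun _ hv => Seq.mem_vars.1 (h.vars_subset (Seq.mem_vars.2 ⟨b, hv⟩)),
    fun _ hA => ((h.bare_left b).not_mem_leaves hA).elim⟩

/-! ### The schematic rules in uniform notation -/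

/-- The scheme that replaces a structural connective by an operational one. -/
def translateScheme (c : OConn L st) (A : Fin c.toS.arity → Fm L st) : Scheme L st :=
  .unary (dirSeq c.inF (.node c.toS fun i => sf (A i)) (sv 0)) (dirSeq c.inF (sf (.app c A)) (sv 0))

/-- The scheme that introduces an operational connective from its arguments. -/
def tonicityScheme (c : OConn L st) (A : Fin c.toS.arity → Fm L st) : Scheme L st :=
  .multi (fun i => dirSeq (c.inF == c.toS.ord i) (sv i) (sf (A i)))
    (dirSeq c.inF (.node c.toS fun i => sv i) (sf (.app c A)))

/-- The structural symbol `s` belongs to a connective of the family `F` (`b = true`) or `G`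
(`b = false`). -/
def Language.Kind (L : Language.{u}) : Bool → L.S → Prop
  | true, s => ∃ f, L.H f = s
  | false, s => ∃ g, L.K g = s

/-- The structure variables `0`, …, `n - 1` as arguments, with the `i`-th one replaced by `Z`. -/
def svUpdate {n : ℕ} (i : Fin n) (Z : SStr L st) : Fin n → SStr L st :=
  Function.update (fun j => sv j) i Z

/-- With `b = true` for a symbol of the family `F` and `b = false` for `G`, the rules for `g` are
those for `f` with the two sides exchanged. The variable with number `L.arity s` is the structure
opposite the symbol. -/
def displayTop (b : Bool) (s : L.S) : SSeq L st :=
  dirSeq b (Str.str s fun j => sv j) (sv (L.arity s))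

def displayBot (b : Bool) (s : L.S) (i : Fin (L.arity s)) : SSeq L st :=
  dirSeq (b == L.ord s i) (sv i) (Str.res s i (svUpdate i (sv (L.arity s))))

def necTop (b : Bool) (s : L.S) (k : Fin (L.arity s)) : SSeq L st :=
  dirSeq (b == L.ord s k) (sv k) Str.I

def necBot (b : Bool) (s : L.S) (k : Fin (L.arity s)) : SSeq L st :=
  dirSeq (b == L.ord s k) (sv k) (Str.res s k (svUpdate k Str.I))

def guardedTop (b : Bool) (s : L.S) (k : Fin (L.arity s)) : Fin (L.arity s) → SSeq L st := fun i =>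
  if i = k then necTop b s k else dirSeq (b == L.ord s i) (sv i) (sv (L.arity s + i))

theorem guardedTop_def (b : Bool) (s : L.S) (k : Fin (L.arity s)) :
    (guardedTop b s k : Fin (L.arity s) → SSeq L st) = fun i =>
      if i = k then dirSeq (b == L.ord s k) (sv k) Str.I
      else dirSeq (b == L.ord s i) (sv i) (sv (L.arity s + i)) := rfl

theorem DoubleLine.display {b : Bool} {s : L.S} (h : L.Kind b s) (i : Fin (L.arity s)) :
    DoubleLine (st := st) (displayTop b s) (displayBot b s i) := by
  cases b
  · obtain ⟨g, rfl⟩ := h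
    simp only [displayBot, Bool.false_beq, dirSeq_not]
    exact .displayG g i
  · obtain ⟨f, rfl⟩ := h
    simp only [displayBot, Bool.true_beq]
    exact .displayF f i

theorem necRule_iff {r : Scheme L st} :
    NecRule r ↔ ∃ b s k, L.Kind b s ∧ r = .unary (necTop b s k) (necBot b s k) := by
  constructor
  · rintro (⟨f, k⟩ | ⟨g, k⟩)
    · exact ⟨true, _, k, ⟨f, rfl⟩, by simp [necTop, necBot, svUpdate]⟩
    · exact ⟨false, _, k, ⟨g, rfl⟩, by simp [necTop, necBot, svUpdate, dirSeq_not]⟩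
  · rintro ⟨_ | _, s, k, ⟨f, rfl⟩, rfl⟩
    · simpa [necTop, necBot, svUpdate, dirSeq_not] using NecRule.necG (st := st) f k
    · simpa [necTop, necBot, svUpdate] using NecRule.necF (st := st) f k

theorem guardedNecRule_iff {r : Scheme L st} :
    GuardedNecRule r ↔
      ∃ b s k, L.Kind b s ∧ r = .multi (guardedTop b s k) (necBot b s k) := by
  constructor
  · rintro (⟨f, k⟩ | ⟨g, k⟩)
    · exact ⟨true, _, k, ⟨f, rfl⟩, by simp [guardedTop_def, necBot, svUpdate]⟩
    · exact ⟨false, _, k, ⟨g, rfl⟩,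
        by simp [guardedTop_def, necBot, svUpdate, dirSeq_not]⟩
  · rintro ⟨_ | _, s, k, ⟨f, rfl⟩, rfl⟩
    · simpa [guardedTop_def, necBot, svUpdate, dirSeq_not] using
        GuardedNecRule.necG (st := st) f k
    · simpa [guardedTop_def, necBot, svUpdate] using
        GuardedNecRule.necF (st := st) f k

/-! ### Regularity of the rules -/

/-- The position of the structure variables in the rules for a structural symbol `s`: the argument
`i` has the number `i`, and the number `n + i` belongs to a structure opposite to it. -/
def symbolPol (b : Bool) (s : L.S) (v : ℕ) : Bool :=
  if h : v < L.arity s then b == L.ord s ⟨v, h⟩ else !b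

theorem vars_svUpdate {n : ℕ} (i j : Fin n) (Z : SStr L st) :
    (svUpdate i Z j).vars = if j = i then Z.vars else {(j : ℕ)} := by
  by_cases h : j = i
  · subst h
    simp [svUpdate]
  · simp [svUpdate, h, Str.vars_sv]

theorem linear_svUpdate (s : L.S) (i : Fin (L.arity s)) {Z : SStr L st} (hZ : Z.Linear)
    (hv : ∀ v ∈ Z.vars, L.arity s ≤ v) : (Str.res s i (svUpdate i Z)).Linear := by
  refine ⟨fun (j : Fin (L.arity s)) => ?_, fun (j k : Fin (L.arity s)) hjk => ?_⟩
  · by_cases h : j = i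
    · subst h
      simpa [svUpdate] using hZ
    · simpa [svUpdate, h] using Str.linear_sv
  · rw [vars_svUpdate, vars_svUpdate]
    by_cases hj : j = i <;> by_cases hk : k = i
    · exact (hjk (hj.trans hk.symm)).elim
    · simp only [hj, hk, if_true, if_false, Set.disjoint_singleton_right]
      exact fun h => absurd (hv _ h) (by omega)
    · simp only [hj, hk, if_true, if_false, Set.disjoint_singleton_left]
      exact fun h => absurd (hv _ h) (by omega)
    · simp only [hj, hk, if_false]
      exact Set.disjoint_singleton.2 fun h => hjk (Fin.ext h)

theorem bare_svUpdate (s : L.S) (i : Fin (L.arity s)) {Z : SStr L st} (hZ : Z.Bare) :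
    (Str.res s i (svUpdate i Z)).Bare := fun (j : Fin (L.arity s)) => by
  by_cases h : j = i
  · subst h
    simpa [svUpdate] using hZ
  · simpa [svUpdate, h] using Str.bare_sv

/-- This is what the order-type of a residual is made for: when argument `i` trades places with the
structure opposite to `s`, the other arguments keep their positions, and the newcomer keeps the
position `!b`. -/
theorem pol_svUpdate {pol : ℕ → Bool} {b : Bool} {s : L.S}
    (hpol : ∀ j : Fin (L.arity s), pol j = (b == L.ord s j)) (i : Fin (L.arity s)) {Z : SStr L st}
    (hZ : Z.Pol pol (!b)) : (Str.res s i (svUpdate i Z)).Pol pol (!(b == L.ord s i)) :=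
  fun (j : Fin (L.arity s)) => by
  by_cases h : j = i
  · subst h
    have : ((!(b == L.ord s j)) == (SConn.res s j).ord j) = !b := by
      simp only [SConn.ord, if_true]
      cases b <;> cases L.ord s j <;> rfl
    simpa [svUpdate, this] using hZ
  · have : ((!(b == L.ord s i)) == (SConn.res s i).ord j) = (b == L.ord s j) := by
      simp only [SConn.ord, h, if_false]
      cases b <;> cases L.ord s i <;> cases L.ord s j <;> rfl
    simpa [svUpdate, h, this, Str.pol_sv] using hpol j

theorem vars_res_svUpdate (s : L.S) (i : Fin (L.arity s)) (Z : SStr L st) :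
    (Str.res s i (svUpdate i Z)).vars = {v | v < L.arity s ∧ v ≠ i} ∪ Z.vars := by
  ext v
  refine Set.mem_iUnion.trans ?_
  change (∃ j : Fin (L.arity s), v ∈ (svUpdate i Z j).vars) ↔ _
  simp only [vars_svUpdate, Set.mem_union, Set.mem_ofPred_eq]
  constructor
  · rintro ⟨j, h⟩
    by_cases hj : j = i
    · exact Or.inr (by simpa [hj] using h)
    · simp only [hj, if_false, Set.mem_singleton_iff] at h
      subst h
      exact Or.inl ⟨j.2, fun h => hj (Fin.ext h)⟩
  · rintro (⟨h, h'⟩ | h)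
    · refine ⟨⟨v, h⟩, ?_⟩
      rw [if_neg (fun e => h' (congrArg Fin.val e))]
      rfl
    · exact ⟨i, by simpa using h⟩

theorem vars_str_sv (s : L.S) :
    (Str.str s fun j => sv j : SStr L st).vars = {v | v < L.arity s} := by
  ext v
  refine Set.mem_iUnion.trans ⟨?_, fun h => ⟨⟨v, h⟩, rfl⟩⟩
  rintro ⟨j, rfl : v = j⟩
  exact j.2

theorem linear_node_sv (c : SConn L) : (.node c fun j => sv j : SStr L st).Linear :=
  ⟨fun _ => trivial, fun _ _ h => Set.disjoint_singleton.2 fun h' => h (Fin.ext h')⟩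

theorem structural_display_down (b : Bool) (s : L.S) (i : Fin (L.arity s)) :
    Structural (st := st) (displayTop b s) (displayBot b s i) where
  pol := by
    have h : ∀ j : Fin (L.arity s), symbolPol b s j = (b == L.ord s j) := by
      intro j
      simp [symbolPol]
    have h' : symbolPol b s (L.arity s) = !b := by simp [symbolPol]
    exact ⟨symbolPol b s, forall_side_dirSeq.2 ⟨h, h'⟩,
      forall_side_dirSeq.2 ⟨h i, pol_svUpdate h i h'⟩⟩
  bare_left := (forall_side_dirSeq (p := fun _ => Str.Bare)).2 ⟨fun _ => trivial, trivial⟩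
  bare_right := (forall_side_dirSeq (p := fun _ => Str.Bare)).2
    ⟨trivial, bare_svUpdate s i trivial⟩
  linear := (forall_side_dirSeq (p := fun _ => Str.Linear)).2
    ⟨trivial, linear_svUpdate s i trivial (by simp [Str.vars_sv])⟩
  disjoint := disjoint_dirSeq <| by
    rw [vars_res_svUpdate, Str.vars_sv, Str.vars_sv, Set.disjoint_singleton_left]
    simp [i.2.ne]
  vars_subset := by
    rw [displayTop, displayBot, vars_dirSeq, vars_dirSeq, vars_res_svUpdate, vars_str_sv]
    rintro v (h | h)
    · by_cases hv : v = i
      · exact Or.inl hv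
      · exact Or.inr (Or.inl ⟨h, hv⟩)
    · exact Or.inr (Or.inr h)

theorem structural_display_up (b : Bool) (s : L.S) (i : Fin (L.arity s)) :
    Structural (st := st) (displayBot b s i) (displayTop b s) where
  pol := by
    obtain ⟨pol, h, h'⟩ := (structural_display_down (st := st) b s i).pol
    exact ⟨pol, h', h⟩
  bare_left := (structural_display_down b s i).bare_right
  bare_right := (structural_display_down b s i).bare_left
  linear := (forall_side_dirSeq (p := fun _ => Str.Linear)).2
    ⟨linear_node_sv (.str s), trivial⟩
  disjoint := disjoint_dirSeq <| by
    rw [vars_str_sv, Str.vars_sv, Set.disjoint_singleton_right]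
    simp
  vars_subset := by
    rw [displayTop, displayBot, vars_dirSeq, vars_dirSeq, vars_res_svUpdate, vars_str_sv]
    rintro v (rfl | ⟨h, -⟩ | h)
    · exact Or.inl i.2
    · exact Or.inl h
    · exact Or.inr h

theorem linear_necBot (b : Bool) (s : L.S) (k : Fin (L.arity s)) :
    ∀ b', ((necBot b s k : SSeq L st).side b').Linear :=
  (forall_side_dirSeq (p := fun _ => Str.Linear)).2
    ⟨trivial, linear_svUpdate s k Str.linear_I (by simp [Str.vars_I])⟩

theorem bare_necBot (b : Bool) (s : L.S) (k : Fin (L.arity s)) :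
    ∀ b', ((necBot b s k : SSeq L st).side b').Bare :=
  (forall_side_dirSeq (p := fun _ => Str.Bare)).2 ⟨trivial, bare_svUpdate s k Str.bare_I⟩

theorem disjoint_necBot (b : Bool) (s : L.S) (k : Fin (L.arity s)) :
    Disjoint (necBot b s k : SSeq L st).ante.vars (necBot b s k : SSeq L st).succ.vars :=
  disjoint_dirSeq <| by
    rw [vars_res_svUpdate, Str.vars_sv, Str.vars_I, Set.disjoint_singleton_left]
    simp

theorem structural_nec (b : Bool) (s : L.S) (k : Fin (L.arity s)) :
    Structural (st := st) (necTop b s k) (necBot b s k) where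
  pol := by
    have h : ∀ j : Fin (L.arity s), symbolPol b s j = (b == L.ord s j) := by
      intro j
      simp [symbolPol]
    exact ⟨symbolPol b s, forall_side_dirSeq.2 ⟨h k, Str.pol_I⟩,
      forall_side_dirSeq.2 ⟨h k, pol_svUpdate h k Str.pol_I⟩⟩
  bare_left := (forall_side_dirSeq (p := fun _ => Str.Bare)).2 ⟨trivial, Str.bare_I⟩
  bare_right := bare_necBot b s k
  linear := linear_necBot b s k
  disjoint := disjoint_necBot b s k
  vars_subset := by
    rw [necTop, necBot, vars_dirSeq, vars_dirSeq, Str.vars_I, Set.union_empty]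
    exact Set.subset_union_left

/-- `Structural` is not available, since the variables `n + i` do not occur in the conclusion.
Regularity restrains such variables only through their positions. -/
theorem regular_guarded (b : Bool) (s : L.S) (k : Fin (L.arity s)) :
    (Scheme.multi (guardedTop b s k) (necBot b s k) : Scheme L st).Regular where
  pol := by
    -- The variable `n + i` is opposite to the variable `i` in its premise, so it has the reverse
    -- sign; larger numbers do not occur and get a default value.
    let pol : ℕ → Bool := fun v => if h : v < L.arity s then b == L.ord s ⟨v, h⟩ else
      if h : v - L.arity s < L.arity s then !(b == L.ord s ⟨v - L.arity s, h⟩) else true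
    have h : ∀ j : Fin (L.arity s), pol j = (b == L.ord s j) := by
      intro j
      simp [pol]
    have h' : ∀ j : Fin (L.arity s), pol (L.arity s + j) = !(b == L.ord s j) := by
      intro j
      simp [pol]
    refine ⟨pol, ?_⟩
    rintro (_ | i)
    · exact forall_side_dirSeq.2 ⟨h k, pol_svUpdate h k Str.pol_I⟩
    · change ∀ b', ((guardedTop b s k i).side b').Pol pol b'
      unfold guardedTop
      split
      · exact forall_side_dirSeq.2 ⟨h k, Str.pol_I⟩
      · exact forall_side_dirSeq.2 ⟨h i, h' i⟩
  linear := linear_necBot b s k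
  disjoint := disjoint_necBot b s k
  display b' := Or.inl (bare_necBot b s k b')

theorem Structural.of_ante_succ {p c : SSeq L st} (pol : ℕ → Bool)
    (hp : p.ante.Pol pol true ∧ p.succ.Pol pol false)
    (hc : c.ante.Pol pol true ∧ c.succ.Pol pol false) (hb : p.ante.Bare ∧ p.succ.Bare)
    (hb' : c.ante.Bare ∧ c.succ.Bare) (hl : c.ante.Linear ∧ c.succ.Linear)
    (hd : Disjoint c.ante.vars c.succ.vars) (hv : p.vars ⊆ c.vars) : Structural p c where
  pol := ⟨pol, forall_side.2 hp, forall_side.2 hc⟩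
  bare_left := (forall_side (p := fun _ => Str.Bare)).2 hb
  bare_right := (forall_side (p := fun _ => Str.Bare)).2 hb'
  linear := (forall_side (p := fun _ => Str.Linear)).2 hl
  disjoint := hd
  vars_subset := hv

theorem DoubleLine.structural {s t : SSeq L st} (h : DoubleLine s t) :
    Structural s t ∧ Structural t s := by
  cases h with
  | displayF f i =>
    have := And.intro (structural_display_down (st := st) true (L.H f) i)
      (structural_display_up (st := st) true (L.H f) i)
    simp only [displayTop, displayBot, Bool.true_beq] at this
    exact this
  | displayG g i =>
    have := And.intro (structural_display_down (st := st) false (L.K g) i)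
      (structural_display_up (st := st) false (L.K g) i)
    simp only [displayTop, displayBot, Bool.false_beq, dirSeq_not] at this
    exact this
  | semi_gt | semi_lt =>
    constructor <;> refine .of_ante_succ (fun v => v == 0 || v == 1) ?_ ?_ ?_ ?_ ?_ ?_ ?_ <;>
      simp [Str.pol_semi, Str.pol_gt, Str.pol_lt, Str.pol_sv, Str.bare_semi, Str.bare_gt,
        Str.bare_lt, Str.bare_sv, Str.linear_semi, Str.linear_gt, Str.linear_lt, Str.linear_sv,
        Str.vars_semi, Str.vars_gt, Str.vars_lt, Str.vars_sv, Seq.vars, Set.insert_subset_iff]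
  | gt_semi | lt_semi =>
    constructor <;> refine .of_ante_succ (fun v => v == 2) ?_ ?_ ?_ ?_ ?_ ?_ ?_ <;>
      simp [Str.pol_semi, Str.pol_gt, Str.pol_lt, Str.pol_sv, Str.bare_semi, Str.bare_gt,
        Str.bare_lt, Str.bare_sv, Str.linear_semi, Str.linear_gt, Str.linear_lt, Str.linear_sv,
        Str.vars_semi, Str.vars_gt, Str.vars_lt, Str.vars_sv, Seq.vars, Set.insert_subset_iff]
  | I_L =>
    constructor <;> refine .of_ante_succ (fun v => v == 0) ?_ ?_ ?_ ?_ ?_ ?_ ?_ <;>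
      simp [Str.pol_semi, Str.pol_sv, Str.pol_I, Str.bare_semi, Str.bare_sv, Str.bare_I,
        Str.linear_semi, Str.linear_sv, Str.linear_I, Str.vars_semi, Str.vars_sv, Str.vars_I,
        Seq.vars]
  | I_R =>
    constructor <;> refine .of_ante_succ (fun v => v == 1) ?_ ?_ ?_ ?_ ?_ ?_ ?_ <;>
      simp [Str.pol_semi, Str.pol_sv, Str.pol_I, Str.bare_semi, Str.bare_sv, Str.bare_I,
        Str.linear_semi, Str.linear_sv, Str.linear_I, Str.vars_semi, Str.vars_sv, Str.vars_I,
        Seq.vars]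
  | A_L =>
    constructor <;> refine .of_ante_succ (fun v => v != 3) ?_ ?_ ?_ ?_ ?_ ?_ ?_ <;>
      simp [Str.pol_semi, Str.pol_sv, Str.bare_semi, Str.bare_sv, Str.linear_semi, Str.linear_sv,
        Str.vars_semi, Str.vars_sv, Seq.vars]
  | A_R =>
    constructor <;> refine .of_ante_succ (fun v => v == 3) ?_ ?_ ?_ ?_ ?_ ?_ ?_ <;>
      simp [Str.pol_semi, Str.pol_sv, Str.bare_semi, Str.bare_sv, Str.linear_semi, Str.linear_sv,
        Str.vars_semi, Str.vars_sv, Seq.vars]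

/-- A rule other than the necessitation rules is an axiom, a structural rule, or a logical rule. -/
theorem BaseRule.classify {r : Scheme L st} (h : BaseRule r) :
    (∃ p : L.At, r = .axiomatic ⟨sf (.atom p), sf (.atom p)⟩) ∨
    (∃ p c, r = .unary p c ∧ Structural p c) ∨
    (∃ c A, r = translateScheme c A) ∨ ∃ c A, r = tonicityScheme c A := by
  cases h with
  | id p => exact Or.inl ⟨p, rfl⟩
  | down h => exact Or.inr (Or.inl ⟨_, _, rfl, h.structural.1⟩)
  | up h => exact Or.inr (Or.inl ⟨_, _, rfl, h.structural.2⟩)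
  | leftF c h A =>
    exact Or.inr (Or.inr (Or.inl ⟨c, A, by simp only [translateScheme, h]; rfl⟩))
  | rightG c h A =>
    exact Or.inr (Or.inr (Or.inl ⟨c, A, by simp only [translateScheme, h]; rfl⟩))
  | rightF c h A =>
    exact Or.inr (Or.inr (Or.inr ⟨c, A, by simp only [tonicityScheme, h, Bool.true_beq]; rfl⟩))
  | leftG c h A =>
    exact Or.inr (Or.inr (Or.inr ⟨c, A, by
      simp only [tonicityScheme, h, Bool.false_beq, dirSeq_not]; rfl⟩))
  | E_L | W_L =>
    refine Or.inr (Or.inl ⟨_, _, rfl, .of_ante_succ (fun v => v != 2) ?_ ?_ ?_ ?_ ?_ ?_ ?_⟩) <;>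
      simp [Str.pol_semi, Str.pol_sv, Str.bare_semi, Str.bare_sv, Str.linear_semi, Str.linear_sv,
        Str.vars_semi, Str.vars_sv, Seq.vars, Set.insert_subset_iff]
  | E_R | W_R =>
    refine Or.inr (Or.inl ⟨_, _, rfl, .of_ante_succ (fun v => v == 2) ?_ ?_ ?_ ?_ ?_ ?_ ?_⟩) <;>
      simp [Str.pol_semi, Str.pol_sv, Str.bare_semi, Str.bare_sv, Str.linear_semi, Str.linear_sv,
        Str.vars_semi, Str.vars_sv, Seq.vars, Set.insert_subset_iff]
  | C_L =>
    refine Or.inr (Or.inl ⟨_, _, rfl, .of_ante_succ (fun v => v == 0) ?_ ?_ ?_ ?_ ?_ ?_ ?_⟩) <;>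
      simp [Str.pol_semi, Str.pol_sv, Str.bare_semi, Str.bare_sv, Str.linear_sv,
        Str.vars_semi, Str.vars_sv, Seq.vars]
  | C_R =>
    refine Or.inr (Or.inl ⟨_, _, rfl, .of_ante_succ (fun v => v == 1) ?_ ?_ ?_ ?_ ?_ ?_ ?_⟩) <;>
      simp [Str.pol_semi, Str.pol_sv, Str.bare_semi, Str.bare_sv, Str.linear_sv,
        Str.vars_semi, Str.vars_sv, Seq.vars]

theorem bare_node_sv (c : SConn L) : (.node c fun j => sv j : SStr L st).Bare := fun _ => trivial

theorem mem_leaves_node_sf {c : SConn L} {A : Fin c.arity → Fm L st} {B : Fm L st} :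
    Sum.inr B ∈ (.node c fun i => sf (A i) : SStr L st).leaves ↔ ∃ i, B = A i := by
  simp [Str.leaves, sf, eq_comm]

theorem vars_node_sf {c : SConn L} (A : Fin c.arity → Fm L st) :
    (.node c fun i => sf (A i) : SStr L st).vars = ∅ := by
  simp [Str.vars, sf]

theorem BaseRule.regular {r : Scheme L st} (h : BaseRule r) : r.Regular := by
  obtain ⟨p, rfl⟩ | ⟨p, c, rfl, hs⟩ | ⟨c, A, rfl⟩ | ⟨c, A, rfl⟩ := h.classify
  · refine ⟨⟨fun _ => true, ?_⟩, ?_, ?_, ?_⟩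
    · rintro (_ | i)
      · rintro (_ | _) <;> trivial
      · exact i.elim0
    · rintro (_ | _) <;> trivial
    · exact Set.disjoint_empty _
    · rintro (_ | _) <;> exact Or.inr ⟨_, rfl⟩
  · exact hs.regular
  -- The only variable is the context, on the side opposite to the connective.
  · refine ⟨⟨fun _ => !c.inF, ?_⟩, ?_, ?_, ?_⟩
    · rintro (_ | i)
      · exact forall_side_dirSeq.2 ⟨trivial, rfl⟩
      · exact forall_side_dirSeq.2 ⟨fun _ => trivial, rfl⟩
    · exact (forall_side_dirSeq (p := fun _ => Str.Linear)).2 ⟨trivial, trivial⟩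
    · exact disjoint_dirSeq (Set.empty_disjoint _)
    · exact (forall_side_dirSeq (p := fun _ t => t.Bare ∨ ∃ A, t = sf A)).2
        ⟨Or.inr ⟨_, rfl⟩, Or.inl trivial⟩
  · refine ⟨⟨fun v => if h : v < c.toS.arity then c.inF == c.toS.ord ⟨v, h⟩ else true, ?_⟩,
      ?_, ?_, ?_⟩
    · rintro (_ | i)
      · refine forall_side_dirSeq.2 ⟨fun i => ?_, trivial⟩
        simp [Str.pol_sv]
      · refine forall_side_dirSeq.2 ⟨?_, trivial⟩
        have hi : (i : ℕ) < c.toS.arity := i.2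
        simp only [Str.pol_sv, hi, dif_pos]
        rfl
    · exact (forall_side_dirSeq (p := fun _ => Str.Linear)).2 ⟨linear_node_sv _, trivial⟩
    · exact disjoint_dirSeq (Set.disjoint_empty _)
    · exact (forall_side_dirSeq (p := fun _ t => t.Bare ∨ ∃ A, t = sf A)).2
        ⟨Or.inl (bare_node_sv _), Or.inr ⟨_, rfl⟩⟩

theorem Seq.exists_side {p : SStr L st → Prop} {b : Bool} {X Y : SStr L st} :
    (∃ b', p ((dirSeq b X Y).side b')) ↔ p X ∨ p Y := by
  rw [Bool.exists_bool]
  cases b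
  · exact Iff.rfl
  · exact or_comm

theorem BaseRule.analytic {r : Scheme L st} (h : BaseRule r) : r.Analytic := by
  obtain ⟨p, rfl⟩ | ⟨p, c, rfl, hs⟩ | ⟨c, A, rfl⟩ | ⟨c, A, rfl⟩ := h.classify
  · exact fun i => i.elim0
  · exact hs.analytic
  · intro i
    refine (forall_side_dirSeq (p := fun _ => Seq.Covers _)).2 ⟨⟨?_, ?_⟩, ?_, ?_⟩
    · simp [vars_node_sf]
    · intro B hB
      obtain ⟨j, rfl⟩ := mem_leaves_node_sf.1 hB
      rw [exists_comm]
      refine ⟨.app c A, (Seq.exists_side (p := fun t => Sum.inr _ ∈ t.leaves ∧ _)).2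
        (Or.inl ⟨rfl, .arg c A j (.refl _)⟩)⟩
    · exact fun v hv => (Seq.exists_side (p := fun t => v ∈ t.vars)).2 (Or.inr hv)
    · exact fun B hB => (Str.Bare.not_mem_leaves (t := sv 0) trivial hB).elim
  · intro i
    refine (forall_side_dirSeq (p := fun _ => Seq.Covers _)).2 ⟨⟨?_, ?_⟩, ?_, ?_⟩
    · exact fun v hv => (Seq.exists_side (p := fun t => v ∈ t.vars)).2
        (Or.inl (Set.mem_iUnion.2 ⟨i, hv⟩))
    · exact fun B hB => (Str.Bare.not_mem_leaves (t := sv i) trivial hB).elim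
    · exact fun v hv => hv.elim
    · intro B hB
      obtain rfl : B = A i := by simpa [sf, Str.leaves] using hB
      rw [exists_comm]
      refine ⟨.app c A, (Seq.exists_side (p := fun t => Sum.inr _ ∈ t.leaves ∧ _)).2
        (Or.inr ⟨rfl, .arg c A i (.refl _)⟩)⟩

theorem NecRule.structural {r : Scheme L st} (h : NecRule r) :
    ∃ p c, r = .unary p c ∧ Structural p c := by
  obtain ⟨b, s, k, -, rfl⟩ := necRule_iff.1 h
  exact ⟨_, _, rfl, structural_nec b s k⟩

theorem GuardedNecRule.regular {r : Scheme L st} (h : GuardedNecRule r) : r.Regular := by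
  obtain ⟨b, s, k, -, rfl⟩ := guardedNecRule_iff.1 h
  exact regular_guarded b s k

theorem GuardedNecRule.bare {r : Scheme L st} (h : GuardedNecRule r) (b : Bool) :
    ((r.seq none).side b).Bare := by
  obtain ⟨b', s, k, -, rfl⟩ := guardedNecRule_iff.1 h
  exact bare_necBot b' s k b

theorem regular_cutScheme (A : Fm L st) : (cutScheme A).Regular := by
  refine ⟨⟨fun v => v == 0, ?_⟩, ?_, ?_, ?_⟩
  · rintro (_ | i)
    · rintro (_ | _) <;> rfl
    · revert i
      exact Fin.forall_fin_two.2
        ⟨forall_side.2 ⟨rfl, trivial⟩, forall_side.2 ⟨trivial, rfl⟩⟩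
  · rintro (_ | _) <;> trivial
  · exact Set.disjoint_singleton.2 zero_ne_one
  · rintro (_ | _) <;> exact Or.inl trivial

/-! ### Derived rules -/

namespace Der

variable {𝓡 : Set (Scheme L st)} {Hy : Set (Sequent L st)} {P Q : Set (Fm L st)}

theorem leaves_subset {s : Sequent L st} (h : Der 𝓡 Hy P Q s) : s.leaves ⊆ Q := by
  cases h <;> assumption

theorem unary {p c : SSeq L st} (h : .unary p c ∈ 𝓡) (σ : ℕ → Structure L st)
    (hQ : (c.inst σ).leaves ⊆ Q) (d : Der 𝓡 Hy P Q (p.inst σ)) : Der 𝓡 Hy P Q (c.inst σ) :=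
  .rule (.unary p c) h σ hQ fun _ => d

theorem iff_of_doubleLine (h𝓡 : {r | BaseRule r} ⊆ 𝓡) {p c : SSeq L st} (h : DoubleLine p c)
    (σ : ℕ → Structure L st) (hQ : (p.inst σ).leaves ⊆ Q) (hQ' : (c.inst σ).leaves ⊆ Q) :
    Der 𝓡 Hy P Q (p.inst σ) ↔ Der 𝓡 Hy P Q (c.inst σ) :=
  ⟨unary (h𝓡 (.down h)) σ hQ', unary (h𝓡 (.up h)) σ hQ⟩

end Der

/-- The assignment of `X`, `Y`, `Z` to the first three structure variables. -/
def assign (X Y Z : Structure L st) : ℕ → Structure L st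
  | 0 => X
  | 1 => Y
  | _ => Z

theorem Seq.leaves_dir {α : Type u} (d : Bool) (X Y : Str L α) :
    (Seq.dir d X Y).leaves = X.leaves ∪ Y.leaves := by
  cases d
  · exact Set.union_comm _ _
  · rfl

namespace Der

variable {𝓡 : Set (Scheme L st)} {Hy : Set (Sequent L st)} {P Q : Set (Fm L st)}

theorem semi_iff_gt (h𝓡 : {r | BaseRule r} ⊆ 𝓡) (b : Bool) {X Y Z : Structure L st}
    (hX : X.leaves ⊆ Q) (hY : Y.leaves ⊆ Q) (hZ : Z.leaves ⊆ Q) :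
    Der 𝓡 Hy P Q (Seq.dir b (X.semi Y) Z) ↔ Der 𝓡 Hy P Q (Seq.dir b Y (X.gt Z)) := by
  cases b
  · have := iff_of_doubleLine (Hy := Hy) (P := P) (Q := Q) h𝓡 .gt_semi (assign X Y Z)
    simp only [Seq.inst, Seq.subst, Str.inst_semi, Str.inst_gt, Str.inst_sv, assign, Seq.leaves,
      Str.leaves_semi, Str.leaves_gt, Set.union_subset_iff] at this
    exact this ⟨hZ, hX, hY⟩ ⟨⟨hX, hZ⟩, hY⟩
  · have := iff_of_doubleLine (Hy := Hy) (P := P) (Q := Q) h𝓡 .semi_gt (assign X Y Z)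
    simp only [Seq.inst, Seq.subst, Str.inst_semi, Str.inst_gt, Str.inst_sv, assign, Seq.leaves,
      Str.leaves_semi, Str.leaves_gt, Set.union_subset_iff] at this
    exact this ⟨⟨hX, hY⟩, hZ⟩ ⟨hY, hX, hZ⟩

theorem semi_iff_lt (h𝓡 : {r | BaseRule r} ⊆ 𝓡) (b : Bool) {X Y Z : Structure L st}
    (hX : X.leaves ⊆ Q) (hY : Y.leaves ⊆ Q) (hZ : Z.leaves ⊆ Q) :
    Der 𝓡 Hy P Q (Seq.dir b (X.semi Y) Z) ↔ Der 𝓡 Hy P Q (Seq.dir b X (Z.lt Y)) := by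
  cases b
  · have := iff_of_doubleLine (Hy := Hy) (P := P) (Q := Q) h𝓡 .lt_semi (assign X Y Z)
    simp only [Seq.inst, Seq.subst, Str.inst_semi, Str.inst_lt, Str.inst_sv, assign, Seq.leaves,
      Str.leaves_semi, Str.leaves_lt, Set.union_subset_iff] at this
    exact this ⟨hZ, hX, hY⟩ ⟨⟨hZ, hY⟩, hX⟩
  · have := iff_of_doubleLine (Hy := Hy) (P := P) (Q := Q) h𝓡 .semi_lt (assign X Y Z)
    simp only [Seq.inst, Seq.subst, Str.inst_semi, Str.inst_lt, Str.inst_sv, assign, Seq.leaves,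
      Str.leaves_semi, Str.leaves_lt, Set.union_subset_iff] at this
    exact this ⟨⟨hX, hY⟩, hZ⟩ ⟨hX, hZ, hY⟩

/-- If some sequent is derivable, then every structure stands, on either side, in a derivable
sequent without further formulas. -/
theorem exists_of_weakening (h𝓡 : {r | BaseRule r} ⊆ 𝓡) {s : Sequent L st} (h : Der 𝓡 Hy P Q s)
    (d : Bool) {X : Structure L st} (hX : X.leaves ⊆ Q) :
    ∃ Y, Der 𝓡 Hy P Q (Seq.dir d X Y) := by
  obtain ⟨V, W⟩ := s
  obtain ⟨hV, hW⟩ := Set.union_subset_iff.1 h.leaves_subset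
  change V.leaves ⊆ Q at hV
  change W.leaves ⊆ Q at hW
  cases d
  -- From `V ⊢ W` weakening gives `V ⊢ W ; X`, and displaying `X` gives `W > V ⊢ X`.
  · refine ⟨W.gt V, (semi_iff_gt h𝓡 false hW hX hV).1 ?_⟩
    have := unary (Hy := Hy) (P := P) (Q := Q) (h𝓡 BaseRule.W_R) (assign X W V)
    simp only [Seq.inst, Seq.subst, Str.inst_semi, Str.inst_sv, assign, Seq.leaves,
      Str.leaves_semi, Set.union_subset_iff] at this
    exact this ⟨hV, hW, hX⟩ h
  -- From `V ⊢ W` weakening gives `X ; V ⊢ W`, and displaying `X` gives `X ⊢ W < V`.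
  · refine ⟨W.lt V, (semi_iff_lt h𝓡 true hX hV hW).1 ?_⟩
    have := unary (Hy := Hy) (P := P) (Q := Q) (h𝓡 BaseRule.W_L) (assign X V W)
    simp only [Seq.inst, Seq.subst, Str.inst_semi, Str.inst_sv, assign, Seq.leaves,
      Str.leaves_semi, Set.union_subset_iff] at this
    exact this ⟨⟨hX, hV⟩, hW⟩ h

end Der

/-- The assignment of the structures `X i` to the first `n` structure variables and of `Y` to the
other ones. -/
def assignFin {n : ℕ} (X : Fin n → Structure L st) (Y : Structure L st) (v : ℕ) : Structure L st :=
  if h : v < n then X ⟨v, h⟩ else Y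

theorem assignFin_val {n : ℕ} (X : Fin n → Structure L st) (Y : Structure L st) (i : Fin n) :
    assignFin X Y i = X i := by
  simp [assignFin]

theorem assignFin_self {n : ℕ} (X : Fin n → Structure L st) (Y : Structure L st) :
    assignFin X Y n = Y := by
  simp [assignFin]

theorem inst_svUpdate (s : L.S) (i : Fin (L.arity s)) (Z : SStr L st) (σ : ℕ → Structure L st) :
    (Str.res s i (svUpdate i Z)).inst σ =
      Str.res s i (Function.update (fun j => σ j) i (Z.inst σ)) := by
  refine congrArg (Str.node (.res s i)) (funext fun (j : Fin (L.arity s)) => ?_)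
  by_cases h : j = i
  · subst h
    simp [svUpdate]
  · simp [svUpdate, h, Str.inst_sv]

namespace Der

variable {𝓡 : Set (Scheme L st)} {Hy : Set (Sequent L st)} {P : Set (Fm L st)}

theorem str_iff_res (h𝓡 : {r | BaseRule r} ⊆ 𝓡) {b : Bool} {s : L.S} (h : L.Kind b s)
    (X : Fin (L.arity s) → Structure L st) (Y : Structure L st) (i : Fin (L.arity s)) :
    Der 𝓡 Hy P Set.univ (Seq.dir b (Str.str s X) Y) ↔
      Der 𝓡 Hy P Set.univ (Seq.dir (b == L.ord s i) (X i)
        (Str.res s i (Function.update X i Y))) := by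
  have := iff_of_doubleLine (Hy := Hy) (P := P) h𝓡 (.display h i) (assignFin X Y)
    (Set.subset_univ _) (Set.subset_univ _)
  simp only [displayTop, displayBot, dirSeq_inst, inst_svUpdate, Str.inst_sv, assignFin_val,
    assignFin_self] at this
  convert this using 3
  refine congrArg (Str.node (.str s)) (funext fun (j : Fin (L.arity s)) => ?_)
  exact (assignFin_val X Y j).symm

/-- The display property: an argument of a structural connective on the side `b` can be displayed. -/
theorem display (h𝓡 : {r | BaseRule r} ⊆ 𝓡) (c : OConn L st)
    (X : Fin c.toS.arity → Structure L st) (Y : Structure L st) (i : Fin c.toS.arity) :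
    ∃ W, ∀ T, Der 𝓡 Hy P Set.univ (Seq.dir c.inF (.node c.toS (Function.update X i T)) Y) ↔
      Der 𝓡 Hy P Set.univ (Seq.dir (c.inF == c.toS.ord i) T W) := by
  have hgt := fun b X Y Z => semi_iff_gt (Hy := Hy) (P := P) h𝓡 b
    (Set.subset_univ (Str.leaves X)) (Set.subset_univ (Str.leaves Y)) (Set.subset_univ (Str.leaves Z))
  have hlt := fun b X Y Z => semi_iff_lt (Hy := Hy) (P := P) h𝓡 b
    (Set.subset_univ (Str.leaves X)) (Set.subset_univ (Str.leaves Y)) (Set.subset_univ (Str.leaves Z))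
  have transport : ∀ {b d : Bool} {f g : Structure L st → Structure L st}, (∀ T, f T = g T) →
      (∃ W, ∀ T, Der 𝓡 Hy P Set.univ (Seq.dir b (g T) Y) ↔
        Der 𝓡 Hy P Set.univ (Seq.dir d T W)) →
      ∃ W, ∀ T, Der 𝓡 Hy P Set.univ (Seq.dir b (f T) Y) ↔
        Der 𝓡 Hy P Set.univ (Seq.dir d T W) := by
    intro b d f g h
    rw [funext h]
    exact id
  have semi : ∀ (b : Bool) (X : Fin 2 → Structure L st) (i : Fin 2), ∃ W, ∀ T,
      Der 𝓡 Hy P Set.univ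
        (Seq.dir b ((Function.update X i T 0).semi (Function.update X i T 1)) Y) ↔
      Der 𝓡 Hy P Set.univ (Seq.dir (b == true) T W) := by
    intro b X
    refine Fin.forall_fin_two.2 ⟨⟨Y.lt (X 1), fun T => ?_⟩, (X 0).gt Y, fun T => ?_⟩
    · simpa using hlt b T (X 1) Y
    · simpa using hgt b (X 0) T Y
  have gt : ∀ (b : Bool) (X : Fin 2 → Structure L st) (i : Fin 2), ∃ W, ∀ T,
      Der 𝓡 Hy P Set.univ
        (Seq.dir b ((Function.update X i T 0).gt (Function.update X i T 1)) Y) ↔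
      Der 𝓡 Hy P Set.univ (Seq.dir (b == (![false, true] : Fin 2 → Bool) i) T W) := by
    intro b X
    -- A structure with `>` is first turned back into one with `;` on the other side. This already
    -- displays the second argument; the first one is then displayed by `<`.
    refine Fin.forall_fin_two.2 ⟨⟨(X 1).lt Y, fun T => ?_⟩, (X 0).semi Y, fun T => ?_⟩
    · rw [← Seq.dir_not b, ← hgt]
      simpa using hlt (!b) T Y (X 1)
    · rw [← Seq.dir_not b, ← hgt, Seq.dir_not]
      simp
  have lt : ∀ (b : Bool) (X : Fin 2 → Structure L st) (i : Fin 2), ∃ W, ∀ T,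
      Der 𝓡 Hy P Set.univ
        (Seq.dir b ((Function.update X i T 0).lt (Function.update X i T 1)) Y) ↔
      Der 𝓡 Hy P Set.univ (Seq.dir (b == (![true, false] : Fin 2 → Bool) i) T W) := by
    intro b X
    refine Fin.forall_fin_two.2 ⟨⟨Y.semi (X 1), fun T => ?_⟩, Y.gt (X 0), fun T => ?_⟩
    · rw [← Seq.dir_not b, ← hlt, Seq.dir_not]
      simp
    · rw [← Seq.dir_not b, ← hlt]
      simpa using hgt (!b) Y T (X 0)
  have str : ∀ (b : Bool) (s : L.S), L.Kind b s → ∀ (X : Fin (L.arity s) → Structure L st)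
      (i : Fin (L.arity s)), ∃ W, ∀ T,
      Der 𝓡 Hy P Set.univ (Seq.dir b (Str.str s (Function.update X i T)) Y) ↔
      Der 𝓡 Hy P Set.univ (Seq.dir (b == L.ord s i) T W) := by
    intro b s hs X i
    refine ⟨Str.res s i (Function.update X i Y), fun T => ?_⟩
    simpa using str_iff_res h𝓡 hs (Function.update X i T) Y i
  have res : ∀ (b : Bool) (s : L.S) (k : Fin (L.arity s)), L.Kind b s →
      ∀ (X : Fin (L.arity s) → Structure L st) (i : Fin (L.arity s)), ∃ W, ∀ T,
      Der 𝓡 Hy P Set.univ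
        (Seq.dir (!(b == L.ord s k)) (Str.res s k (Function.update X i T)) Y) ↔
      Der 𝓡 Hy P Set.univ (Seq.dir ((!(b == L.ord s k)) == (SConn.res s k).ord i) T W) := by
    intro b s k hs X i
    by_cases hik : i = k
    · subst hik
      have hord : ((!(b == L.ord s i)) == (SConn.res s i).ord i) = !b := by
        simp only [SConn.ord, if_true]
        cases b <;> cases L.ord s i <;> rfl
      refine ⟨Str.str s (Function.update X i Y), fun T => ?_⟩
      rw [hord, Seq.dir_not, Seq.dir_not]
      simpa using (str_iff_res h𝓡 hs (Function.update X i Y) T i).symm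
    · have hord : ((!(b == L.ord s k)) == (SConn.res s k).ord i) = (b == L.ord s i) := by
        simp only [SConn.ord, hik, if_false]
        cases b <;> cases L.ord s i <;> cases L.ord s k <;> rfl
      -- For `i ≠ k` the passage goes through the symbol `s` itself: `Y` moves into coordinate `k`
      -- while `X k` moves out, and then coordinate `i` is displayed with `X k` on the opposite
      -- side.
      refine ⟨Str.res s i (Function.update (Function.update X k Y) i (X k)), fun T => ?_⟩
      rw [hord, Seq.dir_not]
      have h₁ := str_iff_res (Hy := Hy) (P := P) h𝓡 hs
        (Function.update (Function.update X i T) k Y) (X k) k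
      have h₂ := str_iff_res (Hy := Hy) (P := P) h𝓡 hs
        (Function.update (Function.update X i T) k Y) (X k) i
      have e₁ : Function.update (Function.update (Function.update X i T) k Y) k (X k) =
          Function.update X i T := by
        rw [Function.update_idem, Function.update_eq_self_iff, Function.update_of_ne (Ne.symm hik)]
      have e₂ : Function.update (Function.update (Function.update X i T) k Y) i (X k) =
          Function.update (Function.update X k Y) i (X k) := by
        rw [Function.update_comm hik, Function.update_idem]
      rw [e₁, Function.update_self] at h₁
      rw [e₂, Function.update_of_ne hik, Function.update_self] at h₂
      exact h₁.symm.trans h₂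
  cases c with
  | top => exact i.elim0
  | bot => exact i.elim0
  | and => exact transport (fun T => Str.node_semi _) (semi true X i)
  | or => exact transport (fun T => Str.node_semi _) (semi false X i)
  | ofF f => exact str true _ ⟨f, rfl⟩ X i
  | ofG g => exact str false _ ⟨g, rfl⟩ X i
  | imp h => exact transport (fun T => Str.node_gt _) (gt false X i)
  | coimp h => exact transport (fun T => Str.node_gt _) (gt true X i)
  | impBy h => exact transport (fun T => Str.node_lt _) (lt false X i)
  | coimpBy h => exact transport (fun T => Str.node_lt _) (lt true X i)
  | sharp h f k =>
    have := res true _ k ⟨f, rfl⟩ X i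
    simp only [Bool.true_beq] at this
    exact this
  | flat h g k =>
    have := res false _ k ⟨g, rfl⟩ X i
    simp only [Bool.false_beq, Bool.not_not] at this
    exact this

theorem cut_dir (d : Bool) {X W : Structure L st} {A : Fm L st} (hA : A ∈ P)
    (h₁ : Der 𝓡 Hy P Set.univ (Seq.dir d X A.str)) (h₂ : Der 𝓡 Hy P Set.univ (Seq.dir d A.str W)) :
    Der 𝓡 Hy P Set.univ (Seq.dir d X W) := by
  cases d
  · exact .cut A hA (Set.subset_univ _) h₂ h₁
  · exact .cut A hA (Set.subset_univ _) h₁ h₂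

/-- The arguments are exchanged one at a time. Displaying one of them makes it an entire side of the
sequent, where a cut applies, and the equivalence in `display` restores the context afterwards. -/
theorem cut_arguments (h𝓡 : {r | BaseRule r} ⊆ 𝓡) (c : OConn L st)
    (A : Fin c.toS.arity → Fm L st) (hA : ∀ i, A i ∈ P) (X : Fin c.toS.arity → Structure L st)
    (Y : Structure L st)
    (h : Der 𝓡 Hy P Set.univ (Seq.dir c.inF (.node c.toS fun i => (A i).str) Y))
    (hX : ∀ i, Der 𝓡 Hy P Set.univ (Seq.dir (c.inF == c.toS.ord i) (X i) (A i).str)) :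
    Der 𝓡 Hy P Set.univ (Seq.dir c.inF (.node c.toS X) Y) := by
  classical
  suffices ∀ t : Finset (Fin c.toS.arity), Der 𝓡 Hy P Set.univ
      (Seq.dir c.inF (.node c.toS fun i => if i ∈ t then X i else (A i).str) Y) by
    simpa using this Finset.univ
  intro t
  induction t using Finset.induction_on with
  | empty => simpa using h
  | insert i t hi ih =>
    obtain ⟨W, hW⟩ := display (Hy := Hy) (P := P) h𝓡 c
      (fun j => if j ∈ t then X j else (A j).str) Y i
    -- Coordinate `i` still holds `A i`, because `i ∉ t`.
    have h₁ := (hW (A i).str).1 (by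
      convert ih using 3
      refine Function.update_eq_self_iff.2 ?_
      simp [hi])
    have h₂ := (hW (X i)).2 (cut_dir _ (hA i) (hX i) h₁)
    convert h₂ using 3
    funext j
    by_cases hj : j = i
    · subst hj
      simp
    · simp [hj]

end Der

/-! ### Principal constituents -/

theorem dirSeq_side_self (d : Bool) (X Y : SStr L st) : (dirSeq d X Y).side d = X := by
  cases d <;> rfl

theorem dirSeq_side_not (d : Bool) (X Y : SStr L st) : (dirSeq d X Y).side (!d) = Y := by
  cases d <;> rfl

/-- The side on which a formula is introduced tells the two kinds of logical rule apart: translation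
puts the formula on the side `c.inF` of its connective, tonicity on the opposite one. -/
theorem BaseRule.of_side_eq_sf {r : Scheme L st} (h : BaseRule r) {d : Bool} {A : Fm L st}
    (e : (r.seq none).side d = sf A) :
    (∃ p : L.At, A = .atom p ∧ r = .axiomatic ⟨sf (.atom p), sf (.atom p)⟩) ∨
    (∃ c B, A = .app c B ∧ c.inF = d ∧ r = translateScheme c B) ∨
    ∃ c B, A = .app c B ∧ c.inF = !d ∧ r = tonicityScheme c B := by
  obtain ⟨p, rfl⟩ | ⟨p, c, rfl, hs⟩ | ⟨c, B, rfl⟩ | ⟨c, B, rfl⟩ := h.classify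
  · refine Or.inl ⟨p, ?_, rfl⟩
    cases d <;> cases e <;> rfl
  · have hb := hs.bare_right d
    change c.side d = sf A at e
    rw [e] at hb
    exact hb.elim
  · refine Or.inr (Or.inl ⟨c, B, ?_⟩)
    change (dirSeq c.inF _ _).side d = sf A at e
    by_cases hd : c.inF = d
    · subst hd
      rw [dirSeq_side_self] at e
      cases e
      exact ⟨rfl, rfl, rfl⟩
    · obtain rfl := (Bool.eq_not_of_ne (Ne.symm hd))
      rw [dirSeq_side_not] at e
      cases e
  · refine Or.inr (Or.inr ⟨c, B, ?_⟩)
    change (dirSeq c.inF _ _).side d = sf A at e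
    by_cases hd : c.inF = d
    · subst hd
      rw [dirSeq_side_self] at e
      cases e
    · obtain rfl := (Bool.eq_not_of_ne (Ne.symm hd))
      rw [dirSeq_side_not] at e
      cases e
      exact ⟨rfl, (Bool.not_not _).symm, rfl⟩

section

variable {𝓡 : Set (Scheme L st)}

/-- This is the principal reduction for both families at once. The translation premise has `S(A)` on
one side, and the tonicity premises supply the cuts that turn each `A i` into `σ i`. -/
theorem Der.of_logical_premises {Hy : Set (Sequent L st)} (h𝓡 : {r | BaseRule r} ⊆ 𝓡)
    (c : OConn L st) (A : Fin c.toS.arity → Fm L st) (σ τ : ℕ → Structure L st)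
    (hσ : ∀ i, ((tonicityScheme c A).seq (some i)).inst σ ∈ Hy)
    (hτ : ∀ i, ((translateScheme c A).seq (some i)).inst τ ∈ Hy) :
    Der 𝓡 Hy {B | Sub B (.app c A) ∧ B ≠ .app c A} Set.univ
      (Seq.dir c.inF (.node c.toS fun i => σ i) (τ 0)) := by
  refine Der.cut_arguments (P := {B | Sub B (.app c A) ∧ B ≠ .app c A}) h𝓡 c A
    (fun i => ⟨.arg c A i (.refl _), Fm.arg_ne_app c A i⟩) _ _ ?_
    fun i => ?_
  · have := Der.hyp (𝓡 := 𝓡) (P := {B | Sub B (.app c A) ∧ B ≠ .app c A}) (hτ (0 : Fin 1))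
      (Set.subset_univ _)
    change Der _ _ _ _ ((dirSeq _ _ _).inst _) at this
    rw [dirSeq_inst] at this
    exact this
  · have := Der.hyp (𝓡 := 𝓡) (P := {B | Sub B (.app c A) ∧ B ≠ .app c A}) (hσ i)
      (Set.subset_univ _)
    change Der _ _ _ _ ((dirSeq _ _ _).inst _) at this
    rw [dirSeq_inst] at this
    exact this

/-- A rule with a bare conclusion introduces no formula, so the necessitation rules play no part.
For a compound formula the side conditions on `c.inF` exclude two translations or two tonicity
rules; the remaining pairs are a translation against a tonicity rule. -/
theorem principalCut (h𝓡 : {r | BaseRule r} ⊆ 𝓡)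
    (h : ∀ r ∈ 𝓡, BaseRule r ∨ ∀ b, ((r.seq none).side b).Bare) : PrincipalCut 𝓡 := by
  intro r₁ hr₁ r₂ hr₂ σ₁ σ₂ A e₁ e₂
  have h₁ : BaseRule r₁ := (h r₁ hr₁).resolve_right fun hb => by
    have := hb false
    rw [show (r₁.seq none).side false = sf A from e₁] at this
    exact this
  have h₂ : BaseRule r₂ := (h r₂ hr₂).resolve_right fun hb => by
    have := hb true
    rw [show (r₂.seq none).side true = sf A from e₂] at this
    exact this
  obtain ⟨p, rfl, rfl⟩ | ⟨c, B, rfl, hc, rfl⟩ | ⟨c, B, rfl, hc, rfl⟩ :=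
      h₁.of_side_eq_sf (d := false) e₁ <;>
    obtain ⟨p', hA, rfl⟩ | ⟨c', B', hA, hc', rfl⟩ | ⟨c', B', hA, hc', rfl⟩ :=
      h₂.of_side_eq_sf (d := true) e₂ <;>
    cases hA
  -- For an atom both inferences are `p ⊢ p`, which is also the conclusion of the cut.
  · exact .rule _ hr₁ σ₁ (Set.subset_univ _) fun i => i.elim0
  · exact absurd (hc.symm.trans hc') Bool.false_ne_true
  · have := Der.of_logical_premises h𝓡 c B σ₂ σ₁
      (fun i => Set.mem_union_right _ (Set.mem_range_self (f := fun i =>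
        ((tonicityScheme c B).seq (some i)).inst σ₂) i))
      (fun i => Set.mem_union_left _ (Set.mem_range_self (f := fun i =>
        ((translateScheme c B).seq (some i)).inst σ₁) i))
    change Der _ _ _ _ ⟨(dirSeq c.inF _ _).ante.inst _, (dirSeq c.inF _ _).succ.inst _⟩
    rw [hc] at this ⊢
    exact this
  · have := Der.of_logical_premises h𝓡 c B σ₁ σ₂
      (fun i => Set.mem_union_left _ (Set.mem_range_self (f := fun i =>
        ((tonicityScheme c B).seq (some i)).inst σ₁) i))
      (fun i => Set.mem_union_right _ (Set.mem_range_self (f := fun i =>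
        ((translateScheme c B).seq (some i)).inst σ₂) i))
    change Der _ _ _ _ ⟨(dirSeq c.inF _ _).ante.inst _, (dirSeq c.inF _ _).succ.inst _⟩
    rw [hc] at this ⊢
    exact this
  · exact absurd (hc'.symm.trans hc) Bool.false_ne_true

/-! ### The conditions for schematic calculi -/

theorem exists_regular_of_mem_allRules (h𝓡 : ∀ r ∈ 𝓡, r.Regular) {R : Rule L st}
    (hR : R ∈ (schematic 𝓡).allRules) : ∃ r : Scheme L st, r.Regular ∧ R = r.toRule := by
  rcases hR with ⟨r, hr, rfl⟩ | ⟨A, rfl⟩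
  · exact ⟨r, h𝓡 r hr, rfl⟩
  · exact ⟨_, regular_cutScheme A, rfl⟩

theorem schematic_c1 (h𝓡 : ∀ r ∈ 𝓡, r.Analytic) : (schematic 𝓡).C1 := by
  rintro _ ⟨r, hr, rfl⟩ _ ⟨σ, rfl⟩ i A hA
  exact (h𝓡 r hr).c1 σ i hA

theorem schematic_c2 (h𝓡 : ∀ r ∈ 𝓡, r.Regular) : (schematic 𝓡).C2 := by
  intro R hR a ha o o' h
  obtain ⟨r, -, rfl⟩ := exists_regular_of_mem_allRules h𝓡 hR
  obtain ⟨σ, rfl⟩ := ha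
  exact Scheme.c2 σ h

theorem schematic_c3 (h𝓡 : ∀ r ∈ 𝓡, r.Regular) : (schematic 𝓡).C3 := by
  intro R hR a ha o o₁ o₂ h₁ h₂ h h'
  obtain ⟨r, hr, rfl⟩ := exists_regular_of_mem_allRules h𝓡 hR
  obtain ⟨σ, rfl⟩ := ha
  exact hr.c3 σ h₁ h₂ h h'

theorem schematic_c4 (h𝓡 : ∀ r ∈ 𝓡, r.Regular) : (schematic 𝓡).C4 := by
  intro R hR a ha o o' h
  obtain ⟨r, hr, rfl⟩ := exists_regular_of_mem_allRules h𝓡 hR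
  obtain ⟨σ, rfl⟩ := ha
  exact hr.c4 σ h

theorem schematic_c5 (h𝓡 : ∀ r ∈ 𝓡, r.Regular) : (schematic 𝓡).C5 := by
  intro R hR a ha o A h
  obtain ⟨r, hr, rfl⟩ := exists_regular_of_mem_allRules h𝓡 hR
  obtain ⟨σ, rfl⟩ := ha
  exact hr.c5 σ h

theorem exists_replaceSeq (h𝓡 : ∀ r ∈ 𝓡, r.Regular) {R : Rule L st}
    (hR : R ∈ (schematic 𝓡).allRules) {a : Application L st R.k} (ha : a ∈ R.apps) {o : Occ R.k}
    (ho : a.IsParam o) (Z : Structure L st) :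
    ∃ a' ∈ R.apps, ∀ l, a'.seq l = a.replaceSeq o Z l := by
  obtain ⟨r, -, rfl⟩ := exists_regular_of_mem_allRules h𝓡 hR
  obtain ⟨σ, rfl⟩ := ha
  obtain ⟨σ', h⟩ := Scheme.exists_inst_replaceSeq σ ho Z
  exact ⟨_, ⟨σ', rfl⟩, h⟩

theorem schematic_c6 (h𝓡 : ∀ r ∈ 𝓡, r.Regular) : (schematic 𝓡).C6 :=
  fun _ hR _ ha _ _ ho _ _ Z => exists_replaceSeq h𝓡 hR ha ho Z

theorem schematic_c7 (h𝓡 : ∀ r ∈ 𝓡, r.Regular) : (schematic 𝓡).C7 :=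
  fun _ hR _ ha _ _ ho _ _ Z => exists_replaceSeq h𝓡 hR ha ho Z

theorem schematic_c8 (h𝓡 : PrincipalCut 𝓡) : (schematic 𝓡).C8 := by
  rintro _ ⟨r₁, hr₁, rfl⟩ _ ⟨σ₁, rfl⟩ _ ⟨r₂, hr₂, rfl⟩ _ ⟨σ₂, rfl⟩ X Y A e₁ p₁ e₂ p₂
  obtain rfl : (r₁.seq none).ante.inst σ₁ = X := congrArg Seq.ante e₁
  obtain rfl : (r₂.seq none).succ.inst σ₂ = Y := congrArg Seq.succ e₂
  obtain ⟨d, hd, -⟩ := (h𝓡 r₁ hr₁ r₂ hr₂ σ₁ σ₂ A (Scheme.side_eq_of_isPrincipal σ₁ p₁)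
    (Scheme.side_eq_of_isPrincipal σ₂ p₂)).exists_derivation
  exact ⟨d, fun B hB => hd hB⟩

end

/-! ### The calculi -/

/-- The schematic rules of the calculus. -/
def calculusSchemes (L : Language.{u}) (st : Bool) : Set (Scheme L st) :=
  {r | BaseRule r ∨ NecRule r}

/-- The schematic rules of the calculus with additional premises in the necessitation rules. -/
def guardedSchemes (L : Language.{u}) (st : Bool) : Set (Scheme L st) :=
  {r | BaseRule r ∨ GuardedNecRule r}

theorem regular_calculusSchemes : ∀ r ∈ calculusSchemes L st, r.Regular := by
  rintro r (hr | hr)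
  · exact hr.regular
  · obtain ⟨p, c, rfl, h⟩ := hr.structural
    exact h.regular

theorem analytic_calculusSchemes : ∀ r ∈ calculusSchemes L st, r.Analytic := by
  rintro r (hr | hr)
  · exact hr.analytic
  · obtain ⟨p, c, rfl, h⟩ := hr.structural
    exact h.analytic

theorem regular_guardedSchemes : ∀ r ∈ guardedSchemes L st, r.Regular := by
  rintro r (hr | hr)
  · exact hr.regular
  · exact hr.regular

theorem principalCut_calculusSchemes : PrincipalCut (calculusSchemes L st) := by
  refine principalCut (fun r hr => Or.inl hr) ?_
  rintro r (hr | hr)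
  · exact Or.inl hr
  · obtain ⟨p, c, rfl, h⟩ := hr.structural
    exact Or.inr h.bare_right

theorem principalCut_guardedSchemes : PrincipalCut (guardedSchemes L st) := by
  refine principalCut (fun r hr => Or.inl hr) ?_
  rintro r (hr | hr)
  · exact Or.inl hr
  · exact Or.inr hr.bare

theorem isProper_calculus (L : Language.{u}) (st : Bool) : (calculus L st).IsProper where
  c1 := schematic_c1 analytic_calculusSchemes
  c2 := schematic_c2 regular_calculusSchemes
  c3 := schematic_c3 regular_calculusSchemes
  c4 := schematic_c4 regular_calculusSchemes
  c5 := schematic_c5 regular_calculusSchemes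
  c6 := schematic_c6 regular_calculusSchemes
  c7 := schematic_c7 regular_calculusSchemes
  c8 := schematic_c8 principalCut_calculusSchemes

/-- Every derivable sequent has a cut-free derivation from subformulas. -/
theorem Der.cut_free {P : Set (Fm L st)} {s : Sequent L st}
    (h : Der (calculusSchemes L st) ∅ P Set.univ s) :
    Der (calculusSchemes L st) ∅ ∅ {A | ∃ B ∈ s.leaves, Sub A B} s :=
  (h.cut_elimination regular_calculusSchemes principalCut_calculusSchemes).restrict
    (Q := {A | ∃ B ∈ s.leaves, Sub A B}) analytic_calculusSchemes
    (fun _ _ hAB ⟨C, hC, hBC⟩ => ⟨C, hC, hAB.trans hBC⟩)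
    fun A hA => ⟨A, hA, .refl A⟩

theorem subformulaProperty_of_der {𝓡 : Set (Scheme L st)}
    (h : ∀ s, (schematic 𝓡).Derivable s → Der 𝓡 ∅ ∅ {A | ∃ B ∈ s.leaves, Sub A B} s) :
    (schematic 𝓡).SubformulaProperty := by
  intro s hs
  obtain ⟨d, h₁, h₂⟩ := (h s hs).exists_derivation
  exact ⟨d, Set.subset_empty_iff.1 h₁, fun A hA => h₂ hA⟩

theorem Calculus.SubformulaProperty.cutElimination {C : Calculus L st} (h : C.SubformulaProperty) :
    C.CutElimination := fun s hs =>
  let ⟨d, hd, _⟩ := h s hs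
  ⟨d, hd⟩

theorem subformulaProperty_calculus (L : Language.{u}) (st : Bool) :
    (calculus L st).SubformulaProperty :=
  subformulaProperty_of_der fun _ ⟨d⟩ => (Der.of_derivation d).cut_free

/-! ### Passage between the plain and the guarded necessitation rules -/

theorem der_calculus_of_guarded {P Q : Set (Fm L st)} {s : Sequent L st}
    (h : Der (guardedSchemes L st) ∅ P Q s) : Der (calculusSchemes L st) ∅ P Q s := by
  induction h with
  | hyp h => exact h.elim
  | cut A hA hQ _ _ ih₁ ih₂ => exact .cut A hA hQ ih₁ ih₂
  | rule r hr σ hQ _ ih =>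
    rcases hr with hr | hr
    · exact .rule r (Or.inl hr) σ hQ ih
    · obtain ⟨b, s, k, hs, rfl⟩ := guardedNecRule_iff.1 hr
      refine Der.unary (p := necTop b s k) (c := necBot b s k)
        (Or.inr (necRule_iff.2 ⟨b, s, k, hs, rfl⟩)) σ hQ ?_
      have := ih k
      change Der _ _ _ _ (Seq.inst (if k = k then necTop b s k else _) σ) at this
      rwa [if_pos rfl] at this

/-- The distinguished premise is derivable, so weakening and display produce from it a derivable
sequent with `X i` on the required side. What stands opposite serves as `Y i`. All formulas used
come from that premise and from the conclusion, so the bound `Q` is preserved, and so is the bound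
`P` on cut formulas. -/
theorem der_guarded_of_calculus {P Q : Set (Fm L st)} {s : Sequent L st}
    (h : Der (calculusSchemes L st) ∅ P Q s) : Der (guardedSchemes L st) ∅ P Q s := by
  induction h with
  | hyp h => exact h.elim
  | cut A hA hQ _ _ ih₁ ih₂ => exact .cut A hA hQ ih₁ ih₂
  | rule r hr σ hQ _ ih =>
    rcases hr with hr | hr
    · exact .rule r (Or.inl hr) σ hQ ih
    · obtain ⟨b, s, k, hs, rfl⟩ := necRule_iff.1 hr
      have ihk : Der (guardedSchemes L st) ∅ P Q ((necTop b s k).inst σ) := ih (0 : Fin 1)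
      change ((necBot b s k).inst σ).leaves ⊆ Q at hQ
      have hσ : ∀ i : Fin (L.arity s), i ≠ k → (σ i).leaves ⊆ Q := by
        intro i hi
        refine subset_trans ?_ hQ
        rw [necBot, dirSeq_inst, Seq.leaves_dir, inst_svUpdate]
        refine subset_trans ?_ Set.subset_union_right
        have := Set.subset_iUnion (fun j : Fin (L.arity s) =>
          (Function.update (fun j : Fin (L.arity s) => σ j) k (Str.I.inst σ) j).leaves) i
        rwa [Function.update_of_ne hi] at this
      have hY : ∀ i : Fin (L.arity s), ∃ Y, i ≠ k → Der (guardedSchemes L st) ∅ P Q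
          (Seq.dir (b == L.ord s i) (σ i) Y) := by
        intro i
        by_cases hi : i = k
        · exact ⟨Str.I, fun h => (h hi).elim⟩
        · obtain ⟨Y, h⟩ := ihk.exists_of_weakening (fun r hr => Or.inl hr) (b == L.ord s i) (hσ i hi)
          exact ⟨Y, fun _ => h⟩
      choose Y hY using hY
      -- The arguments keep their values, so the conclusion is unchanged; the variable `n + i`
      -- receives the structure found by weakening.
      let τ : ℕ → Structure L st := fun v => if v < L.arity s then σ v else
        if h : v - L.arity s < L.arity s then Y ⟨v - L.arity s, h⟩ else Str.I
      have hτ : ∀ i : Fin (L.arity s), τ i = σ i := fun i => if_pos i.2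
      have hτ' : ∀ i : Fin (L.arity s), τ (L.arity s + i) = Y i := by
        intro i
        simp [τ]
      have hbot : (necBot b s k).inst τ = (necBot b s k).inst σ := by
        simp only [necBot, dirSeq_inst, inst_svUpdate, Str.inst_I, Str.inst_sv, hτ]
      have hprem : ∀ i, Der (guardedSchemes L st) ∅ P Q ((guardedTop b s k i).inst τ) := by
        intro i
        unfold guardedTop
        split
        · have : (necTop b s k).inst τ = (necTop b s k).inst σ := by
            simp only [necTop, dirSeq_inst, Str.inst_I, Str.inst_sv, hτ]
          rwa [this]
        · rename_i hi
          simpa only [dirSeq_inst, Str.inst_sv, hτ, hτ'] using hY i hi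
      have := Der.rule (.multi (guardedTop b s k) (necBot b s k))
        (Or.inr (guardedNecRule_iff.2 ⟨b, s, k, hs, rfl⟩)) τ (by
          change ((necBot b s k).inst τ).leaves ⊆ Q
          rwa [hbot]) hprem
      change Der _ _ _ _ ((necBot b s k).inst τ) at this
      rw [hbot] at this
      exact this

/-- C₁ cannot be used for the guarded rules. The derivation is carried to the plain calculus, made
cut-free and analytic there, and carried back without cuts and without formulas outside the bound.
-/
theorem subformulaProperty_guardedCalculus (L : Language.{u}) (st : Bool) :
    (guardedCalculus L st).SubformulaProperty :=
  subformulaProperty_of_der fun _ ⟨d⟩ =>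
    der_guarded_of_calculus (der_calculus_of_guarded (Der.of_derivation d)).cut_free

theorem derivable_guardedCalculus_iff (s : Sequent L st) :
    (guardedCalculus L st).Derivable s ↔ (calculus L st).Derivable s := by
  constructor
  · rintro ⟨d⟩
    obtain ⟨d', -⟩ := (der_calculus_of_guarded (Der.of_derivation d)).exists_derivation
    exact ⟨d'⟩
  · rintro ⟨d⟩
    obtain ⟨d', -⟩ := (der_guarded_of_calculus (Der.of_derivation d)).exists_derivation
    exact ⟨d'⟩

end DLE

theorem mainTheorem10 (L : DLE.Language.{u}) :
    ((DLE.DL L).IsProper ∧ (DLE.DL L).CutElimination ∧ (DLE.DL L).SubformulaProperty) ∧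
    ((DLE.DLstar L).IsProper ∧ (DLE.DLstar L).CutElimination ∧
      (DLE.DLstar L).SubformulaProperty) ∧
    (∀ st : Bool,
      (DLE.guardedCalculus L st).C2 ∧ (DLE.guardedCalculus L st).C3 ∧
      (DLE.guardedCalculus L st).C4 ∧ (DLE.guardedCalculus L st).C5 ∧
      (DLE.guardedCalculus L st).C6 ∧ (DLE.guardedCalculus L st).C7 ∧
      (DLE.guardedCalculus L st).C8 ∧ (DLE.guardedCalculus L st).CutElimination ∧
      (DLE.guardedCalculus L st).SubformulaProperty ∧
      ∀ s, (DLE.guardedCalculus L st).Derivable s ↔ (DLE.calculus L st).Derivable s) := by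
  have hL := fun st => DLE.subformulaProperty_calculus L st
  refine ⟨⟨DLE.isProper_calculus L false, (hL false).cutElimination, hL false⟩,
    ⟨DLE.isProper_calculus L true, (hL true).cutElimination, hL true⟩, fun st => ?_⟩
  have hG := DLE.subformulaProperty_guardedCalculus L st
  have hr := DLE.regular_guardedSchemes (L := L) (st := st)
  exact ⟨DLE.schematic_c2 hr, DLE.schematic_c3 hr, DLE.schematic_c4 hr, DLE.schematic_c5 hr,
    DLE.schematic_c6 hr, DLE.schematic_c7 hr,
    DLE.schematic_c8 DLE.principalCut_guardedSchemes, hG.cutElimination, hG,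
    DLE.derivable_guardedCalculus_iff⟩
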